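/- **One-sided Counting Lemma.** *Notation.* Graphs are simple. For disjoint finite vertex sets $U,W$ of a graph $G$ let $e_G(U,W)$ be the number of edges of $G$ between $U$ and $W$, and for $0<p\le 1$ let $d_p(U,W)=e_G(U,W)/(p|U||W|)$ (read as $0$ if $U$ or $W$ is empty). The pair $(U,W)$ is $(\varepsilon,p)$-regular in $G$ if $|d_p(U',W')-d_p(U,W)|\le\varepsilon$ for all $U'\subseteq U$, $W'\subseteq W$ with $|U'|\ge\varepsilon|U|$ and $|W'|\ge\varepsilon|W|$. It is $(p,\beta)$-bijumbled in a graph $\Gamma$ if $\big|e_\Gamma(U',W')-p|U'||W'|\big|\le\beta\sqrt{|U'||W'|}$ for all $U'\subseteq U$, $W'\subseteq W$. Let $H$ be a graph with vertex set $[m]$, in its natural order. Write $N^-(v)$ for the set of neighbours $w<v$ of $v$ in $H$, and $N^{<u}(v)$ for the set of neighbours $w<u$ of $v$ in $H$. Let $k_{\mathrm{reg}}(H)$ be the smallest real number such that * for all $i<j$ with $ij\in E(H)$, $$k_{\mathrm{reg}}(H)\ \ge\ \tfrac12|N^-(i)|+\tfrac12|N^{<i}(j)|+t(i,j),$$ where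 $t(i,j)=3$ if there is $k>i$ with $jk,ik\in E(H)$ and $|N^{<i}(k)|\le|N^{<i}(j)|$; otherwise $t(i,j)=2$ if there is $k>i$ with $jk,ik\in E(H)$; otherwise $t(i,j)=\tfrac32$ if there is $k>i$ with $jk\in E(H)$; and otherwise $t(i,j)=1$; * for all $i$ and all $j,j'>i$ with $ij,jj'\in E(H)$, $$k_{\mathrm{reg}}(H)\ \ge\ \tfrac12|N^{<i}(j)|+\tfrac12|N^{<i}(j')|+s,$$ where $s=2.501$ if $ij'\in E(H)$ and $s=2.001$ otherwise. (If $H$ has no edges, $k_{\mathrm{reg}}(H)$ is not needed.) *Statement.* For every graph $H$ with vertex set $[m]$ and every $\gamma>0$ there exist $\varepsilon,c>0$ such that the following holds for every $0<p\le 1$. Let $G\subseteq\Gamma$ be graphs on a common vertex set, and let $V_1,\dots,V_m$ be finite sets of vertices. Suppose that for each edge $ij\in E(H)$ the sets $V_i$ and $V_j$ are disjoint, and the pair $(V_i,V_j)$ is $(\varepsilon,p)$-regular in $G$ and $\big(p,\,c\,p^{k_{\mathrm{reg}}(H)}\sqrt{|V_i||V_j|}\big)$-bijumbled in $\Gamma$.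 Let $n(H;G)$ be the number of labelled partite copies of $H$ in $G$, that is, of tuples $(v_1,\dots,v_m)\in V_1\times\dots\times V_m$ with $v_iv_j\in E(G)$ for every $ij\in E(H)$ (if $V_1,\dots,V_m$ are pairwise disjoint, the $v_i$ are automatically distinct). Then $$n(H;G)\ \ge\ \Big(\prod_{ij\in E(H)}d_p(V_i,V_j)-\gamma\Big)\,p^{e(H)}\prod_{i=1}^m|V_i|.$$ -/

import Mathlib

open Finset

noncomputable section

namespace SparseCounting

/-! ### Sparse regularity and bijumbledness -/

open Classical in
/-- `e(U, W)`: the number of pairs `(u, w)` with `u ∈ U`, `w ∈ W` and `uw` an edge of `G`.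
For disjoint `U`, `W` this is the number of edges of `G` between `U` and `W`. -/
def edgesBetween {V : Type*} (G : SimpleGraph V) (U W : Finset V) : ℕ :=
  (G.interedges U W).card

/-- The `p`-density `d_p(U, W) = e(U, W) / (p |U| |W|)`. -/
def pDensity {V : Type*} (G : SimpleGraph V) (p : ℝ) (U W : Finset V) : ℝ :=
  (edgesBetween G U W : ℝ) / (p * (U.card : ℝ) * (W.card : ℝ))

/-- The pair `(U, W)` is `(ε, p)`-regular in `G`. -/
def IsRegularPair {V : Type*} (G : SimpleGraph V) (ε p : ℝ) (U W : Finset V) : Prop :=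
  ∀ U' ⊆ U, ∀ W' ⊆ W, ε * (U.card : ℝ) ≤ (U'.card : ℝ) → ε * (W.card : ℝ) ≤ (W'.card : ℝ) →
    |pDensity G p U' W' - pDensity G p U W| ≤ ε

/-- The pair `(U, W)` is `(p, β)`-bijumbled in `Γ`. -/
def IsBijumbledPair {V : Type*} (Γ : SimpleGraph V) (p β : ℝ) (U W : Finset V) : Prop :=
  ∀ U' ⊆ U, ∀ W' ⊆ W,
    |(edgesBetween Γ U' W' : ℝ) - p * (U'.card : ℝ) * (W'.card : ℝ)|
      ≤ β * √((U'.card : ℝ) * (W'.card : ℝ))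

/-! ### Partite copies -/

open Classical in
/-- The edges `ij` of `H`, each listed once with its smaller endpoint first. -/
def orderedEdges {m : ℕ} (H : SimpleGraph (Fin m)) : Finset (Fin m × Fin m) :=
  univ.filter fun e => e.1 < e.2 ∧ H.Adj e.1 e.2

/-- `d(H; G)`: the product of the `p`-densities `d_p(V_i, V_j)` over the edges `ij` of `H`. -/
def densityProd {V : Type*} {m : ℕ} (H : SimpleGraph (Fin m)) (G : SimpleGraph V) (p : ℝ)
    (W : Fin m → Finset V) : ℝ :=
  ∏ e ∈ orderedEdges H, pDensity G p (W e.1) (W e.2)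

open Classical in
/-- `n(H; G)`: the number of ways to choose the image `f i ∈ W i` of each vertex `i` of `H` so
that edges of `H` go to edges of `G`. Adjacent vertices always get distinct images; if the sets
`W i` are pairwise disjoint then all images are distinct. -/
def partiteCopies {V : Type*} {m : ℕ} (H : SimpleGraph (Fin m)) (G : SimpleGraph V)
    (W : Fin m → Finset V) : ℕ :=
  ((Fintype.piFinset W).filter fun f => ∀ i j, H.Adj i j → G.Adj (f i) (f j)).card

/-! ### The exponent `k_reg(H)` -/

open Classical in
/-- `|N^{<u}(v)|`: the number of neighbours of `v` in `H` which precede `u`.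
In particular `numBefore H v v` is `|N^-(v)|`. -/
def numBefore {m : ℕ} (H : SimpleGraph (Fin m)) (u v : Fin m) : ℕ :=
  (univ.filter fun w => H.Adj v w ∧ w < u).card

open Classical in
/-- The summand given by the four cases in the first family of lower bounds on `k_reg(H)`;
when several cases apply, the largest value counts. -/
def caseTerm {m : ℕ} (H : SimpleGraph (Fin m)) (i j : Fin m) : ℝ :=
  if ∃ k, i < k ∧ H.Adj j k ∧ H.Adj i k ∧ numBefore H i k ≤ numBefore H i j then 3
  else if ∃ k, i < k ∧ H.Adj j k ∧ H.Adj i k then 2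
  else if ∃ k, i < k ∧ H.Adj j k then 3 / 2
  else 1

open Classical in
/-- `k` satisfies all the lower bounds which define `k_reg(H)`. -/
def IsKRegBound {m : ℕ} (H : SimpleGraph (Fin m)) (k : ℝ) : Prop :=
  (∀ i j, i < j → H.Adj i j →
    (numBefore H i i : ℝ) / 2 + (numBefore H i j : ℝ) / 2 + caseTerm H i j ≤ k) ∧
  (∀ i j j', i < j → i < j' → H.Adj i j → H.Adj j j' →
    (numBefore H i j : ℝ) / 2 + (numBefore H i j' : ℝ) / 2
      + (if H.Adj i j' then 2.501 else 2.001) ≤ k)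

/-- `k_reg(H)`: the smallest number satisfying all these lower bounds, for the natural order on
the vertex set. (If `H` has no edge there are no bounds, and the value is irrelevant.) -/
def kReg {m : ℕ} (H : SimpleGraph (Fin m)) : ℝ := sInf {k | IsKRegBound H k}

theorem numBefore_le {m : ℕ} (H : SimpleGraph (Fin m)) (u v : Fin m) :
    (numBefore H u v : ℝ) ≤ m := by
  classical
  have h : numBefore H u v ≤ m := by
    unfold numBefore
    exact (card_le_univ _).trans (by simp)
  exact_mod_cast h

theorem caseTerm_le {m : ℕ} (H : SimpleGraph (Fin m)) (i j : Fin m) : caseTerm H i j ≤ 3 := by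
  unfold caseTerm
  split_ifs <;> norm_num

/-- If `H` has an edge then `k_reg(H)` is attained. -/
theorem kReg_isLeast {m : ℕ} (H : SimpleGraph (Fin m)) {a b : Fin m} (hab : H.Adj a b) :
    IsLeast {k | IsKRegBound H k} (kReg H) := by
  have hne : {k | IsKRegBound H k}.Nonempty := by
    refine ⟨(m : ℝ) + 3, fun i j _ _ => ?_, fun i j j' _ _ _ _ => ?_⟩
    · linarith [numBefore_le H i i, numBefore_le H i j, caseTerm_le H i j]
    · have h1 := numBefore_le H i j
      have h2 := numBefore_le H i j'
      split_ifs <;> norm_num <;> linarith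
  refine ⟨⟨fun i j hij h => le_csInf hne fun k hk => hk.1 i j hij h,
    fun i j j' h1 h2 h3 h4 => le_csInf hne fun k hk => hk.2 i j j' h1 h2 h3 h4⟩,
    fun k hk => csInf_le ?_ hk⟩
  rcases lt_or_gt_of_ne hab.ne with h | h
  · exact ⟨_, fun k hk => hk.1 a b h hab⟩
  · exact ⟨_, fun k hk => hk.1 b a h hab.symm⟩

end SparseCounting

end

namespace SparseCounting

universe u

variable {α β ζ ι : Type*} {V : Type u}

/-! The vertices of `H` are embedded one at a time. Once vertex 0 is mapped to `v`, the candidate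
set of each neighbour of 0 shrinks to its part adjacent to `v`, and the count of `H` is the sum over
`v` of the counts of `H` without 0 (`partiteCopies_succ`). It is enough that most `v` have almost
the expected degrees and leave every remaining edge of `H` with a regular pair of candidate sets.
The other `v` are dropped, which is harmless for a lower bound. Jumbledness passes to subsets, but
measured against sets shrunk by a factor `p` it loses `p^(1/2)` per embedded neighbour of either
end. The terms `|N|/2` in the exponent pay for this, so that exponents 3/2, 2 and 3 are still
available when needed.

The substance is that regularity is inherited by neighbourhoods, although these have relative size
only about `p`. Regularity of a pair is expressed as small cut norm of the signed kernel `g = G - q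
p`. Small cut norm forces most codegrees `∑ y, g x y * g x' y` to be small
(`DominatedPair.codegree_sum_le`). If many apices `z` were bad, let `S x z` indicate a witness set
inside the neighbourhood of `z`. The second moment of `∑ x, g x y * S x z` over `y`, `z` pairs
codegrees of `g` with codegrees of `S`; the latter are dominated by those of a jumbled kernel, so
the second moment is small (`DominatedPair.sum_sq_comp_le`). Cauchy–Schwarz then contradicts badness
when only one side is restricted (`InheritancePair.one_sided`). When both sides are restricted,
Cauchy–Schwarz is weighted by the kernel on `Y × Z`, which jumbledness with `p ^ 3` allows to be
replaced by the constant `p` (`InheritancePair.two_sided`). This replacement under a square,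
`Jumbled.sum_mul_sq_le`, is the recurring tool. -/

/-- The kernel `F` is within `b √(|A||B|)` of the constant `p` on every `A × B ⊆ X × Y`. -/
def Jumbled (F : α → β → ℝ) (p b : ℝ) (X : Finset α) (Y : Finset β) : Prop :=
  ∀ A ⊆ X, ∀ B ⊆ Y, |∑ x ∈ A, ∑ y ∈ B, (F x y - p)| ≤ b * √((#A : ℝ) * #B)

/-- The cut norm of the kernel `g` on `X × Y` is at most `τ`. -/
def CutClose (g : α → β → ℝ) (τ : ℝ) (X : Finset α) (Y : Finset β) : Prop :=
  ∀ A ⊆ X, ∀ B ⊆ Y, |∑ x ∈ A, ∑ y ∈ B, g x y| ≤ τ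

/-! ### Jumbled kernels tested against bounded weights -/

theorem sqrt_interp {S u : ℝ} (hS : 0 ≤ S) (h0 : 0 ≤ u) (h1 : u ≤ 1) :
    (1 - u) * √S + u * √(S + 1) ≤ √(S + u) := by
  apply Real.le_sqrt_of_sq_le
  have e1 := Real.sq_sqrt hS
  have e2 := Real.sq_sqrt (by linarith : (0 : ℝ) ≤ S + 1)
  have : 0 ≤ u * (1 - u) * (√S - √(S + 1)) ^ 2 :=
    mul_nonneg (mul_nonneg h0 (by linarith)) (sq_nonneg _)
  nlinarith

/-- The left side is linear in each single weight and the right side is concave in it, so the bound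
at weights 0 and 1 interpolates. The offsets `t` and `s` record the elements already decided to lie
in the subset, which is what the induction needs. -/
theorem abs_sum_mul_le_aux [DecidableEq α] (ℓ u : α → ℝ) {b : ℝ} (hb : 0 ≤ b) (X : Finset α)
    (hu : ∀ x ∈ X, 0 ≤ u x ∧ u x ≤ 1) :
    ∀ t s : ℝ, 0 ≤ s → (∀ A ⊆ X, |t + ∑ x ∈ A, ℓ x| ≤ b * √(s + #A)) →
      |t + ∑ x ∈ X, ℓ x * u x| ≤ b * √(s + ∑ x ∈ X, u x) := by
  induction X using Finset.induction_on with
  | empty => intro t s hs h; simpa using h ∅ (by simp)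
  | insert x X hx ih =>
    intro t s hs h
    have hu' : ∀ x ∈ X, 0 ≤ u x ∧ u x ≤ 1 := fun y hy => hu y (mem_insert_of_mem hy)
    have h1 := ih hu' t s hs fun A hA => h A (hA.trans (subset_insert _ _))
    have h2 := ih hu' (t + ℓ x) (s + 1) (by linarith) fun A hA => by
      have hxA : x ∉ A := fun h => hx (hA h)
      have := h (insert x A) (insert_subset_insert _ hA)
      rw [sum_insert hxA, card_insert_of_notMem hxA] at this
      push_cast at this
      rw [add_assoc t, add_assoc s, add_comm (1 : ℝ)]
      exact this
    obtain ⟨h0, h1'⟩ := hu x (mem_insert_self _ _)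
    rw [sum_insert hx, sum_insert hx]
    set σ := ∑ x ∈ X, u x with hσ
    have hσ0 : 0 ≤ σ := sum_nonneg fun y hy => (hu' y hy).1
    set L := ∑ x ∈ X, ℓ x * u x
    have e : t + (ℓ x * u x + L) = (1 - u x) * (t + L) + u x * (t + ℓ x + L) := by ring
    rw [e]
    calc |(1 - u x) * (t + L) + u x * (t + ℓ x + L)|
        ≤ (1 - u x) * |t + L| + u x * |t + ℓ x + L| := by
          refine (abs_add_le _ _).trans_eq ?_
          rw [abs_mul, abs_mul, abs_of_nonneg h0, abs_of_nonneg (by linarith : 0 ≤ 1 - u x)]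
      _ ≤ (1 - u x) * (b * √(s + σ)) + u x * (b * √(s + 1 + σ)) := by
          gcongr
      _ = b * ((1 - u x) * √(s + σ) + u x * √(s + σ + 1)) := by
          rw [show s + 1 + σ = s + σ + 1 by ring]; ring
      _ ≤ b * √(s + σ + u x) := by
          gcongr; exact sqrt_interp (by positivity) h0 h1'
      _ = b * √(s + (u x + σ)) := by rw [show s + σ + u x = s + (u x + σ) by ring]

/-- A bound on subset sums which is concave in the size of the subset extends to `[0,1]`-valued
weights. -/
theorem abs_sum_mul_le (ℓ u : α → ℝ) {b : ℝ} (hb : 0 ≤ b) (X : Finset α)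
    (hu : ∀ x ∈ X, 0 ≤ u x ∧ u x ≤ 1) (h : ∀ A ⊆ X, |∑ x ∈ A, ℓ x| ≤ b * √(#A : ℝ)) :
    |∑ x ∈ X, ℓ x * u x| ≤ b * √(∑ x ∈ X, u x) := by
  classical
  simpa using abs_sum_mul_le_aux ℓ u hb X hu 0 0 le_rfl (by simpa using h)

theorem Jumbled.bilin_unit {F : α → β → ℝ} {p b : ℝ} {X : Finset α} {Y : Finset β}
    (h : Jumbled F p b X Y) (hb : 0 ≤ b) {u : α → ℝ} {v : β → ℝ}
    (hu : ∀ x ∈ X, 0 ≤ u x ∧ u x ≤ 1) (hv : ∀ y ∈ Y, 0 ≤ v y ∧ v y ≤ 1) :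
    |∑ x ∈ X, ∑ y ∈ Y, (F x y - p) * (u x * v y)|
      ≤ b * √(∑ x ∈ X, u x) * √(∑ y ∈ Y, v y) := by
  have key := abs_sum_mul_le (fun y => ∑ x ∈ X, (F x y - p) * u x) v
    (b := b * √(∑ x ∈ X, u x)) (by positivity) Y hv fun B hB => by
    have := abs_sum_mul_le (fun x => ∑ y ∈ B, (F x y - p)) u (b := b * √(#B : ℝ))
      (by positivity) X hu fun A hA => by
      refine (h A hA B hB).trans_eq ?_
      rw [Real.sqrt_mul (by positivity)]; ring
    rw [sum_comm]
    simp only [sum_mul] at this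
    refine this.trans_eq ?_
    ring
  refine le_trans (le_of_eq ?_) key
  congr 1
  rw [sum_comm]
  refine sum_congr rfl fun y _ => ?_
  rw [sum_mul]
  exact sum_congr rfl fun x _ => by ring

/-- Rescaling to weights in `[0,1]` turns the error into `b √(M U N V)`: sup norm and `L¹` norm of
each weight enter symmetrically. The free parameter `K` keeps square roots out of the applications.
-/
theorem Jumbled.bilin_nonneg {F : α → β → ℝ} {p b : ℝ} {X : Finset α} {Y : Finset β}
    (h : Jumbled F p b X Y) (hb : 0 ≤ b) {u : α → ℝ} {v : β → ℝ} {M N U V K : ℝ}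
    (hM : 0 < M) (hN : 0 < N) (hK : 0 ≤ K)
    (hu : ∀ x ∈ X, 0 ≤ u x ∧ u x ≤ M) (hv : ∀ y ∈ Y, 0 ≤ v y ∧ v y ≤ N)
    (hU : ∑ x ∈ X, u x ≤ U) (hV : ∑ y ∈ Y, v y ≤ V) (hMK : (M * U) * (N * V) ≤ K ^ 2) :
    |∑ x ∈ X, ∑ y ∈ Y, (F x y - p) * (u x * v y)| ≤ b * K := by
  have h1 := h.bilin_unit hb (u := fun x => u x / M) (v := fun y => v y / N)
    (fun x hx => ⟨div_nonneg (hu x hx).1 hM.le, (div_le_one hM).2 (hu x hx).2⟩)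
    (fun x hx => ⟨div_nonneg (hv x hx).1 hN.le, (div_le_one hN).2 (hv x hx).2⟩)
  have hU0 : 0 ≤ ∑ x ∈ X, u x := sum_nonneg fun x hx => (hu x hx).1
  have hV0 : 0 ≤ ∑ y ∈ Y, v y := sum_nonneg fun y hy => (hv y hy).1
  have e : ∑ x ∈ X, ∑ y ∈ Y, (F x y - p) * (u x * v y)
      = (M * N) * ∑ x ∈ X, ∑ y ∈ Y, (F x y - p) * (u x / M * (v y / N)) := by
    simp only [mul_sum]
    refine sum_congr rfl fun x _ => sum_congr rfl fun y _ => ?_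
    field_simp
  rw [e, abs_mul, abs_of_pos (mul_pos hM hN)]
  refine (mul_le_mul_of_nonneg_left h1 (mul_pos hM hN).le).trans ?_
  rw [← sum_div, ← sum_div, mul_assoc b, ← Real.sqrt_mul (by positivity), mul_left_comm]
  refine mul_le_mul_of_nonneg_left ?_ hb
  refine abs_le_of_sq_le_sq' ?_ hK |>.2
  rw [mul_pow, Real.sq_sqrt (by positivity)]
  have : (M * N) ^ 2 * ((∑ x ∈ X, u x) / M * ((∑ y ∈ Y, v y) / N))
      = (M * ∑ x ∈ X, u x) * (N * ∑ y ∈ Y, v y) := by field_simp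
  rw [this]
  refine le_trans ?_ hMK
  gcongr
  exact mul_nonneg hM.le (hU0.trans hU)

/-- A jumbled kernel acts as a constant on bounded weights. -/
theorem Jumbled.bilin {F : α → β → ℝ} {p b : ℝ} {X : Finset α} {Y : Finset β}
    (h : Jumbled F p b X Y) (hb : 0 ≤ b) {u : α → ℝ} {v : β → ℝ} {M N U V K : ℝ}
    (hM : 0 < M) (hN : 0 < N) (hK : 0 ≤ K)
    (hu : ∀ x ∈ X, |u x| ≤ M) (hv : ∀ y ∈ Y, |v y| ≤ N)
    (hU : ∑ x ∈ X, |u x| ≤ U) (hV : ∑ y ∈ Y, |v y| ≤ V) (hMK : (M * U) * (N * V) ≤ K ^ 2) :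
    |∑ x ∈ X, ∑ y ∈ Y, (F x y - p) * (u x * v y)| ≤ 4 * (b * K) := by
  have hpos : ∀ t : ℝ, 0 ≤ t⁺ ∧ t⁺ ≤ |t| := fun t => ⟨posPart_nonneg t, by
    rw [posPart_def]; exact sup_le (le_abs_self t) (abs_nonneg t)⟩
  have hneg : ∀ t : ℝ, 0 ≤ t⁻ ∧ t⁻ ≤ |t| := fun t => ⟨negPart_nonneg t, by
    rw [negPart_def]; exact sup_le (neg_le_abs t) (abs_nonneg t)⟩
  have main : ∀ (s s' : ℝ → ℝ), (∀ t, 0 ≤ s t ∧ s t ≤ |t|) → (∀ t, 0 ≤ s' t ∧ s' t ≤ |t|) →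
      |∑ x ∈ X, ∑ y ∈ Y, (F x y - p) * (s (u x) * s' (v y))| ≤ b * K := fun s s' hs hs' =>
    h.bilin_nonneg hb hM hN hK (fun x hx => ⟨(hs _).1, (hs _).2.trans (hu x hx)⟩)
      (fun x hx => ⟨(hs' _).1, (hs' _).2.trans (hv x hx)⟩)
      ((sum_le_sum fun x _ => (hs _).2).trans hU) ((sum_le_sum fun x _ => (hs' _).2).trans hV) hMK
  have a1 := main _ _ hpos hpos
  have a2 := main _ _ hpos hneg
  have a3 := main _ _ hneg hpos
  have a4 := main _ _ hneg hneg
  -- Splitting both weights into positive and negative parts produces the four terms behind the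
  -- factor 4.
  have e : ∑ x ∈ X, ∑ y ∈ Y, (F x y - p) * (u x * v y)
      = ∑ x ∈ X, ∑ y ∈ Y, (F x y - p) * ((u x)⁺ * (v y)⁺)
        - ∑ x ∈ X, ∑ y ∈ Y, (F x y - p) * ((u x)⁺ * (v y)⁻)
        - ∑ x ∈ X, ∑ y ∈ Y, (F x y - p) * ((u x)⁻ * (v y)⁺)
        + ∑ x ∈ X, ∑ y ∈ Y, (F x y - p) * ((u x)⁻ * (v y)⁻) := by
    simp only [← sum_sub_distrib, ← sum_add_distrib]
    refine sum_congr rfl fun x _ => sum_congr rfl fun y _ => ?_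
    conv_lhs => rw [← posPart_sub_negPart (u x), ← posPart_sub_negPart (v y)]
    ring
  rw [e]
  rw [abs_le] at a1 a2 a3 a4 ⊢
  constructor <;> linarith [a1.1, a1.2, a2.1, a2.2, a3.1, a3.2, a4.1, a4.2]

theorem Jumbled.mono {F : α → β → ℝ} {p b b' : ℝ} {X X' : Finset α} {Y Y' : Finset β}
    (h : Jumbled F p b X Y) (hb : b ≤ b') (hX : X' ⊆ X) (hY : Y' ⊆ Y) : Jumbled F p b' X' Y' :=
  fun A hA B hB => (h A (hA.trans hX) B (hB.trans hY)).trans (by gcongr)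

theorem CutClose.mono {g : α → β → ℝ} {τ τ' : ℝ} {X X' : Finset α} {Y Y' : Finset β}
    (h : CutClose g τ X Y) (hb : τ ≤ τ') (hX : X' ⊆ X) (hY : Y' ⊆ Y) : CutClose g τ' X' Y' :=
  fun A hA B hB => (h A (hA.trans hX) B (hB.trans hY)).trans hb

theorem Jumbled.swap {F : α → β → ℝ} {p b : ℝ} {X : Finset α} {Y : Finset β}
    (h : Jumbled F p b X Y) : Jumbled (fun y x => F x y) p b Y X := fun B hB A hA => by
  rw [sum_comm, mul_comm (#B : ℝ)]; exact h A hA B hB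

theorem CutClose.swap {g : α → β → ℝ} {τ : ℝ} {X : Finset α} {Y : Finset β}
    (h : CutClose g τ X Y) : CutClose (fun y x => g x y) τ Y X := fun B hB A hA => by
  rw [sum_comm]; exact h A hA B hB

/-! ### Consequences of small cut norm, and Cauchy–Schwarz inequalities -/

/-- The sign of the inner sum splits `Y` into two sets, on each of which the cut norm bound applies.
-/
theorem CutClose.sum_abs_le {g : α → β → ℝ} {τ : ℝ} {X : Finset α} {Y : Finset β}
    (h : CutClose g τ X Y) {A : Finset α} (hA : A ⊆ X) :
    ∑ y ∈ Y, |∑ x ∈ A, g x y| ≤ 2 * τ := by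
  classical
  rw [← sum_filter_add_sum_filter_not Y (fun y => 0 ≤ ∑ x ∈ A, g x y)]
  have h1 := h A hA (Y.filter fun y => 0 ≤ ∑ x ∈ A, g x y) (filter_subset _ _)
  have h2 := h A hA (Y.filter fun y => ¬ 0 ≤ ∑ x ∈ A, g x y) (filter_subset _ _)
  rw [sum_comm, abs_le] at h1 h2
  have e1 : ∑ y ∈ Y with 0 ≤ ∑ x ∈ A, g x y, |∑ x ∈ A, g x y|
      = ∑ y ∈ Y with 0 ≤ ∑ x ∈ A, g x y, ∑ x ∈ A, g x y :=
    sum_congr rfl fun y hy => abs_of_nonneg (mem_filter.1 hy).2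
  have e2 : ∑ y ∈ Y with ¬ 0 ≤ ∑ x ∈ A, g x y, |∑ x ∈ A, g x y|
      = - ∑ y ∈ Y with ¬ 0 ≤ ∑ x ∈ A, g x y, ∑ x ∈ A, g x y := by
    rw [← sum_neg_distrib]
    exact sum_congr rfl fun y hy => abs_of_neg (not_le.1 (mem_filter.1 hy).2)
  rw [e1, e2]
  linarith [h1.2, h2.1]

theorem CutClose.sum_abs_sign_le {g : α → β → ℝ} {τ : ℝ} {X : Finset α} {Y : Finset β}
    (h : CutClose g τ X Y) {σ : α → ℝ} (hσ : ∀ x, σ x = 1 ∨ σ x = -1) :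
    ∑ y ∈ Y, |∑ x ∈ X, σ x * g x y| ≤ 4 * τ := by
  classical
  have h1 := h.sum_abs_le (filter_subset (fun x => σ x = 1) X)
  have h2 := h.sum_abs_le (filter_subset (fun x => ¬ σ x = 1) X)
  have : ∀ y ∈ Y, |∑ x ∈ X, σ x * g x y|
      ≤ |∑ x ∈ X with σ x = 1, g x y| + |∑ x ∈ X with ¬ σ x = 1, g x y| := fun y _ => by
    rw [← sum_filter_add_sum_filter_not X (fun x => σ x = 1)]
    have e1 : ∑ x ∈ X with σ x = 1, σ x * g x y = ∑ x ∈ X with σ x = 1, g x y :=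
      sum_congr rfl fun x hx => by rw [(mem_filter.1 hx).2, one_mul]
    have e2 : ∑ x ∈ X with ¬ σ x = 1, σ x * g x y = - ∑ x ∈ X with ¬ σ x = 1, g x y := by
      rw [← sum_neg_distrib]
      exact sum_congr rfl fun x hx => by
        rw [(hσ x).resolve_left (mem_filter.1 hx).2, neg_one_mul]
    rw [e1, e2, ← sub_eq_add_neg]
    exact abs_sub _ _
  refine (sum_le_sum this).trans ?_
  rw [sum_add_distrib]
  linarith

theorem sq_sum_mul_le_of_abs_le {s : Finset ι} {f w h : ι → ℝ} (hf : ∀ i ∈ s, |f i| ≤ w i) :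
    (∑ i ∈ s, f i * h i) ^ 2 ≤ (∑ i ∈ s, w i) * ∑ i ∈ s, w i * h i ^ 2 := by
  have hw : ∀ i ∈ s, 0 ≤ w i := fun i hi => (abs_nonneg _).trans (hf i hi)
  have h1 := sum_sq_le_sum_mul_sum_of_sq_le_mul s (r := fun i => w i * |h i|) hw
    (fun i hi => mul_nonneg (hw i hi) (sq_nonneg (h i))) (fun i _ => by
      rw [mul_pow, sq_abs]; exact le_of_eq (by ring))
  refine le_trans ?_ h1
  refine sq_le_sq' ?_ ?_
  · rw [← sum_neg_distrib]
    refine sum_le_sum fun i hi => ?_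
    have := mul_le_mul_of_nonneg_right (hf i hi) (abs_nonneg (h i))
    rw [← abs_mul] at this
    linarith [neg_abs_le (f i * h i)]
  · refine sum_le_sum fun i hi => ?_
    have := mul_le_mul_of_nonneg_right (hf i hi) (abs_nonneg (h i))
    rw [← abs_mul] at this
    linarith [le_abs_self (f i * h i)]

theorem sum_sum_sqrt_mul_le {s : Finset ι} {U V : ι → ι → ℝ} (hU : ∀ i j, 0 ≤ U i j)
    (hV : ∀ i j, 0 ≤ V i j) :
    ∑ i ∈ s, ∑ j ∈ s, √(U i j * V i j)
      ≤ √((∑ i ∈ s, ∑ j ∈ s, U i j) * ∑ i ∈ s, ∑ j ∈ s, V i j) := by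
  have := Real.sum_sqrt_mul_sqrt_le (s ×ˢ s) (f := fun q => U q.1 q.2) (g := fun q => V q.1 q.2)
    (fun q => hU _ _) (fun q => hV _ _)
  rw [sum_product, sum_product, sum_product, ← Real.sqrt_mul
    (sum_nonneg fun i _ => sum_nonneg fun j _ => hU i j)] at this
  refine le_trans (le_of_eq ?_) this
  exact sum_congr rfl fun i _ => sum_congr rfl fun j _ => Real.sqrt_mul (hU i j) _

theorem sum_rotate (I : Finset ι) (J : Finset ζ) (A : Finset α) (f : ι → ζ → α → ℝ) :
    ∑ i ∈ I, ∑ j ∈ J, ∑ a ∈ A, f i j a = ∑ a ∈ A, ∑ i ∈ I, ∑ j ∈ J, f i j a :=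
  (sum_congr rfl fun _ _ => sum_comm).trans sum_comm

theorem sum_sum_sum_abs_mul {s : Finset ι} {A : Finset α} (u : ι → α → ℝ) :
    ∑ i ∈ s, ∑ j ∈ s, ∑ a ∈ A, |u i a * u j a| = ∑ a ∈ A, (∑ i ∈ s, |u i a|) ^ 2 := by
  simp_rw [sq, sum_mul_sum, abs_mul]
  exact sum_rotate _ _ _ _

/-- Under the square of a sum of rank-one kernels, `F` may be replaced by `p`. Expanding the square
gives, for each pair `(i, j)`, a product of a function of `x` and a function of `y`, to which
`Jumbled.bilin` applies. The errors `√(U i j * V i j)` are summed over pairs by Cauchy–Schwarz, and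
the sum of all `U i j` is again a sum of squares. -/
theorem Jumbled.sum_mul_sq_le {F : α → β → ℝ} {p b : ℝ} {A : Finset α} {B : Finset β}
    (h : Jumbled F p b A B) (hb : 0 ≤ b) {s : Finset ι} {u : ι → α → ℝ} {v : ι → β → ℝ}
    {M N K : ℝ} (hM : 0 < M) (hN : 0 < N) (hK : 0 ≤ K)
    (hu : ∀ i ∈ s, ∀ a ∈ A, |u i a| ≤ M) (hv : ∀ i ∈ s, ∀ a ∈ B, |v i a| ≤ N)
    (hUV : (∑ a ∈ A, (∑ i ∈ s, |u i a|) ^ 2) * (∑ a ∈ B, (∑ i ∈ s, |v i a|) ^ 2) ≤ K ^ 2) :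
    ∑ x ∈ A, ∑ y ∈ B, F x y * (∑ i ∈ s, u i x * v i y) ^ 2
      ≤ p * ∑ x ∈ A, ∑ y ∈ B, (∑ i ∈ s, u i x * v i y) ^ 2 + 4 * b * M * N * K := by
  set U : ι → ι → ℝ := fun i j => ∑ a ∈ A, |u i a * u j a| with hUdef
  set V : ι → ι → ℝ := fun i j => ∑ a ∈ B, |v i a * v j a| with hVdef
  have hU0 : ∀ i j, 0 ≤ U i j := fun i j => sum_nonneg fun _ _ => abs_nonneg _
  have hV0 : ∀ i j, 0 ≤ V i j := fun i j => sum_nonneg fun _ _ => abs_nonneg _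
  have e : ∑ x ∈ A, ∑ y ∈ B, F x y * (∑ i ∈ s, u i x * v i y) ^ 2
      = p * ∑ x ∈ A, ∑ y ∈ B, (∑ i ∈ s, u i x * v i y) ^ 2
        + ∑ i ∈ s, ∑ j ∈ s, ∑ x ∈ A, ∑ y ∈ B,
          (F x y - p) * ((u i x * u j x) * (v i y * v j y)) := by
    have : ∑ i ∈ s, ∑ j ∈ s, ∑ x ∈ A, ∑ y ∈ B,
          (F x y - p) * ((u i x * u j x) * (v i y * v j y))
        = ∑ x ∈ A, ∑ y ∈ B, (F x y - p) * (∑ i ∈ s, u i x * v i y) ^ 2 := by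
      simp_rw [sq, sum_mul_sum, mul_sum]
      rw [sum_rotate]
      refine sum_congr rfl fun x _ => ?_
      rw [sum_rotate]
      refine sum_congr rfl fun y _ => sum_congr rfl fun i _ => sum_congr rfl fun j _ => ?_
      ring
    rw [this]
    simp_rw [mul_sum, ← sum_add_distrib]
    refine sum_congr rfl fun x _ => sum_congr rfl fun y _ => ?_
    ring
  rw [e]
  gcongr
  calc ∑ i ∈ s, ∑ j ∈ s, ∑ x ∈ A, ∑ y ∈ B,
          (F x y - p) * ((u i x * u j x) * (v i y * v j y))
      ≤ ∑ i ∈ s, ∑ j ∈ s, 4 * (b * (M * N * √(U i j * V i j))) := by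
        refine sum_le_sum fun i hi => sum_le_sum fun j hj => ?_
        refine (le_abs_self _).trans (h.bilin (M := M ^ 2) (N := N ^ 2) (U := U i j) (V := V i j)
          hb (by positivity) (by positivity) (by positivity) ?_ ?_ le_rfl le_rfl ?_)
        · intro a ha
          rw [abs_mul, sq]
          exact mul_le_mul (hu i hi a ha) (hu j hj a ha) (abs_nonneg _) hM.le
        · intro a ha
          rw [abs_mul, sq]
          exact mul_le_mul (hv i hi a ha) (hv j hj a ha) (abs_nonneg _) hN.le
        · rw [mul_pow, Real.sq_sqrt (mul_nonneg (hU0 i j) (hV0 i j))]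
          exact le_of_eq (by ring)
    _ = 4 * b * M * N * ∑ i ∈ s, ∑ j ∈ s, √(U i j * V i j) := by
        simp_rw [mul_sum]
        refine sum_congr rfl fun x _ => sum_congr rfl fun y _ => ?_
        ring
    _ ≤ 4 * b * M * N * K := by
        gcongr
        refine (sum_sum_sqrt_mul_le hU0 hV0).trans ?_
        rw [sum_sum_sum_abs_mul, sum_sum_sum_abs_mul]
        exact (Real.sqrt_le_sqrt hUV).trans_eq (Real.sqrt_sq hK)

/-! ### Codegrees of a dominated signed kernel -/

/-- A signed kernel `g` on `X × Y`, dominated by a kernel `Γ` which is jumbled and has no vertices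
of large degree. The sizes of `X`, `Y` are bounded by `a`, `b`. -/
structure DominatedPair (g Γ : α → β → ℝ) (p c a b : ℝ) (X : Finset α) (Y : Finset β) :
    Prop where
  card_left : (#X : ℝ) ≤ a
  card_right : (#Y : ℝ) ≤ b
  nonneg : ∀ x ∈ X, ∀ y ∈ Y, 0 ≤ Γ x y
  le_one : ∀ x ∈ X, ∀ y ∈ Y, Γ x y ≤ 1
  abs_le : ∀ x ∈ X, ∀ y ∈ Y, |g x y| ≤ Γ x y + 2 * p
  degree_left : ∀ x ∈ X, ∑ y ∈ Y, Γ x y ≤ 2 * p * b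
  degree_right : ∀ y ∈ Y, ∑ x ∈ X, Γ x y ≤ 2 * p * a
  jumbled : Jumbled Γ p (c * p ^ 2 * √(a * b)) X Y

section
variable {g Γ : α → β → ℝ} {p c a b : ℝ} {X : Finset α} {Y : Finset β}

theorem DominatedPair.a_nonneg (h : DominatedPair g Γ p c a b X Y) : 0 ≤ a :=
  (Nat.cast_nonneg _).trans h.card_left

theorem DominatedPair.b_nonneg (h : DominatedPair g Γ p c a b X Y) : 0 ≤ b :=
  (Nat.cast_nonneg _).trans h.card_right

theorem DominatedPair.abs_le_three (h : DominatedPair g Γ p c a b X Y) (hp1 : p ≤ 1)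
    {x : α} (hx : x ∈ X) {y : β} (hy : y ∈ Y) : |g x y| ≤ 3 := by
  linarith [h.abs_le x hx y hy, h.le_one x hx y hy]

theorem DominatedPair.weight_left (h : DominatedPair g Γ p c a b X Y) (hp : 0 < p)
    {x : α} (hx : x ∈ X) : ∑ y ∈ Y, (Γ x y + 2 * p) ≤ 4 * p * b := by
  rw [sum_add_distrib, sum_const, nsmul_eq_mul]
  nlinarith [h.degree_left x hx, h.card_right]

theorem DominatedPair.weight_right (h : DominatedPair g Γ p c a b X Y) (hp : 0 < p)
    {y : β} (hy : y ∈ Y) : ∑ x ∈ X, (Γ x y + 2 * p) ≤ 4 * p * a := by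
  rw [sum_add_distrib, sum_const, nsmul_eq_mul]
  nlinarith [h.degree_right y hy, h.card_left]

theorem DominatedPair.sum_abs_right (h : DominatedPair g Γ p c a b X Y) (hp : 0 < p)
    {y : β} (hy : y ∈ Y) : ∑ x ∈ X, |g x y| ≤ 4 * p * a :=
  (sum_le_sum fun x hx => h.abs_le x hx y hy).trans (h.weight_right hp hy)

theorem DominatedPair.sum_sq_right (h : DominatedPair g Γ p c a b X Y) (hp : 0 < p) :
    ∑ y ∈ Y, (∑ x ∈ X, |g x y|) ^ 2 ≤ 16 * p ^ 2 * a ^ 2 * b := by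
  calc ∑ y ∈ Y, (∑ x ∈ X, |g x y|) ^ 2 ≤ ∑ y ∈ Y, (4 * p * a) ^ 2 :=
        sum_le_sum fun y hy => pow_le_pow_left₀ (sum_nonneg fun _ _ => abs_nonneg _)
          (h.sum_abs_right hp hy) 2
    _ ≤ 16 * p ^ 2 * a ^ 2 * b := by
        rw [sum_const, nsmul_eq_mul]
        nlinarith [h.card_right, sq_nonneg (p * a)]

/-- In a cut-close dominated pair most codegrees of the signed kernel are small. -/
theorem DominatedPair.codegree_sum_le (h : DominatedPair g Γ p c a b X Y) (hp : 0 < p)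
    (hp1 : p ≤ 1) (hc : 0 ≤ c) {ε δ : ℝ} (hδ : 0 ≤ δ)
    (hcut : CutClose g (ε * p * a * b) X Y) (hεδ : 192 * (ε + c) ≤ δ ^ 2) :
    ∑ x ∈ X, ∑ x' ∈ X, |∑ y ∈ Y, g x y * g x' y| ≤ δ * p ^ 2 * a ^ 2 * b := by
  have ha := h.a_nonneg
  have hb := h.b_nonneg
  -- The signs make the sum of absolute codegrees linear: it becomes the inner product of `g` with
  -- the kernel `f` below.
  set σ : α → α → ℝ := fun x x' => if 0 ≤ ∑ y ∈ Y, g x y * g x' y then 1 else -1 with hσ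
  have hσ1 : ∀ x x', σ x x' = 1 ∨ σ x x' = -1 := fun x x' => by
    simp only [hσ]; split_ifs <;> simp
  have hσa : ∀ x x', |σ x x'| = 1 := fun x x' => by rcases hσ1 x x' with e | e <;> simp [e]
  set f : α → β → ℝ := fun x y => ∑ x' ∈ X, σ x x' * g x' y with hf
  have e : ∑ x ∈ X, ∑ x' ∈ X, |∑ y ∈ Y, g x y * g x' y| = ∑ x ∈ X, ∑ y ∈ Y, g x y * f x y := by
    refine sum_congr rfl fun x _ => ?_
    simp only [hf, mul_sum]
    rw [sum_comm]
    refine sum_congr rfl fun x' _ => ?_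
    have : |∑ y ∈ Y, g x y * g x' y| = σ x x' * ∑ y ∈ Y, g x y * g x' y := by
      simp only [hσ]
      split_ifs with h0
      · rw [abs_of_nonneg h0, one_mul]
      · rw [abs_of_neg (not_le.1 h0), neg_one_mul]
    rw [this, mul_sum]
    exact sum_congr rfl fun y _ => by ring
  have hfsup : ∀ x, ∀ y ∈ Y, |f x y| ≤ 4 * p * a := fun x y hy => by
    refine (abs_sum_le_sum_abs _ _).trans (le_trans (sum_le_sum fun x' _ => ?_)
      (h.sum_abs_right hp hy))
    rw [abs_mul, hσa, one_mul]
  -- For fixed `x`, `f x` is a signed sum of rows of `g`. Its `L¹` norm is at most four times the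
  -- cut norm bound and its sup norm at most `4 * p * a`; together these control the second moment.
  have hfsq : ∑ x ∈ X, ∑ y ∈ Y, f x y ^ 2 ≤ 16 * ε * p ^ 2 * a ^ 3 * b := by
    have hx : ∀ x ∈ X, ∑ y ∈ Y, f x y ^ 2 ≤ 16 * ε * p ^ 2 * a ^ 2 * b := fun x _ => by
      calc ∑ y ∈ Y, f x y ^ 2 ≤ ∑ y ∈ Y, 4 * p * a * |f x y| := sum_le_sum fun y hy => by
            rw [← sq_abs, sq]
            exact mul_le_mul_of_nonneg_right (hfsup x y hy) (abs_nonneg _)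
        _ = 4 * p * a * ∑ y ∈ Y, |f x y| := by rw [mul_sum]
        _ ≤ 4 * p * a * (4 * (ε * p * a * b)) := by
            gcongr
            exact hcut.sum_abs_sign_le (hσ1 x)
        _ = _ := by ring
    have h0 : 0 ≤ 16 * ε * p ^ 2 * a ^ 2 * b := by
      have := (abs_nonneg _).trans (hcut ∅ (empty_subset _) ∅ (empty_subset _))
      have : 0 ≤ (ε * p * a * b) * (16 * p * a) := mul_nonneg this (by positivity)
      linarith
    calc ∑ x ∈ X, ∑ y ∈ Y, f x y ^ 2 ≤ ∑ x ∈ X, 16 * ε * p ^ 2 * a ^ 2 * b := sum_le_sum hx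
      _ ≤ a * (16 * ε * p ^ 2 * a ^ 2 * b) := by
          rw [sum_const, nsmul_eq_mul]
          exact mul_le_mul_of_nonneg_right h.card_left h0
      _ = _ := by ring
  -- By definition `f` is a sum of rank-one kernels indexed by `x'`. The resulting error `48 * c * p
  -- ^ 3 * a ^ 3 * b` has the order of the main term because the jumbledness carries the factor `p ^
  -- 2`.
  have hsq := h.jumbled.sum_mul_sq_le (by positivity) (s := X) (u := fun x' x => σ x x')
    (v := fun x' y => g x' y) (M := 1) (N := 3) (K := 4 * p * a ^ 2 * √(a * b))
    one_pos three_pos (by positivity) (fun i _ j _ => (hσa _ _).le)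
    (fun i hi j hj => h.abs_le_three hp1 hi hj) (by
      rw [mul_pow, Real.sq_sqrt (by positivity)]
      have h1 : ∑ x ∈ X, (∑ i ∈ X, |σ x i|) ^ 2 ≤ a ^ 3 := by
        simp only [hσa, sum_const, nsmul_eq_mul, mul_one]
        calc (#X : ℝ) * #X ^ 2 = (#X : ℝ) ^ 3 := by ring
          _ ≤ a ^ 3 := pow_le_pow_left₀ (Nat.cast_nonneg _) h.card_left 3
      refine (mul_le_mul h1 (h.sum_sq_right hp) (sum_nonneg fun _ _ => sq_nonneg _)
        (by positivity)).trans (le_of_eq (by ring)))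
  have hsq' : ∑ x ∈ X, ∑ y ∈ Y, (Γ x y + 2 * p) * f x y ^ 2
      ≤ 48 * (ε + c) * p ^ 3 * a ^ 3 * b := by
    have e1 : ∑ x ∈ X, ∑ y ∈ Y, (Γ x y + 2 * p) * f x y ^ 2
        = ∑ x ∈ X, ∑ y ∈ Y, Γ x y * f x y ^ 2 + 2 * p * ∑ x ∈ X, ∑ y ∈ Y, f x y ^ 2 := by
      simp_rw [mul_sum, ← sum_add_distrib, add_mul]
    have e2 : 4 * (c * p ^ 2 * √(a * b)) * 1 * 3 * (4 * p * a ^ 2 * √(a * b))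
        = 48 * c * p ^ 3 * a ^ 3 * b := by
      linear_combination (48 * c * p ^ 3 * a ^ 2) * Real.mul_self_sqrt (mul_nonneg ha hb)
    rw [e2] at hsq
    rw [e1]
    nlinarith [hsq, mul_le_mul_of_nonneg_left hfsq hp.le]
  -- Cauchy–Schwarz uses the weight `Γ + 2 * p`, which dominates `|g|` and has total mass at most `4
  -- * p * a * b`.
  have hcs := sq_sum_mul_le_of_abs_le (s := X ×ˢ Y) (f := fun q => g q.1 q.2)
    (w := fun q => Γ q.1 q.2 + 2 * p) (h := fun q => f q.1 q.2)
    (fun q hq => h.abs_le _ (mem_product.1 hq).1 _ (mem_product.1 hq).2)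
  rw [sum_product, sum_product, sum_product] at hcs
  rw [e]
  refine abs_le_of_sq_le_sq' ?_ (by positivity) |>.2
  refine hcs.trans ?_
  have hw : ∑ x ∈ X, ∑ y ∈ Y, (Γ x y + 2 * p) ≤ 4 * p * a * b := by
    calc ∑ x ∈ X, ∑ y ∈ Y, (Γ x y + 2 * p) ≤ ∑ x ∈ X, 4 * p * b :=
          sum_le_sum fun x hx => h.weight_left hp hx
      _ ≤ a * (4 * p * b) := by
          rw [sum_const, nsmul_eq_mul]
          exact mul_le_mul_of_nonneg_right h.card_left (by positivity)
      _ = _ := by ring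
  have hn : 0 ≤ ∑ x ∈ X, ∑ y ∈ Y, (Γ x y + 2 * p) * f x y ^ 2 :=
    sum_nonneg fun x hx => sum_nonneg fun y hy =>
      mul_nonneg (by linarith [h.nonneg x hx y hy]) (sq_nonneg _)
  calc _ ≤ (4 * p * a * b) * (48 * (ε + c) * p ^ 3 * a ^ 3 * b) :=
        mul_le_mul hw hsq' hn (by positivity)
    _ = (192 * (ε + c)) * (p ^ 2 * a ^ 2 * b) ^ 2 := by ring
    _ ≤ δ ^ 2 * (p ^ 2 * a ^ 2 * b) ^ 2 := by gcongr
    _ = _ := by ring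

end

/-! ### Codegrees weighted by the codegrees of a second kernel -/

theorem Jumbled.sum_le {F : α → β → ℝ} {p b : ℝ} {X : Finset α} {Y : Finset β}
    (h : Jumbled F p b X Y) (hp : 0 ≤ p) (hb : 0 ≤ b) {u : α → ℝ} {v : β → ℝ} {M U V K : ℝ}
    (hM : 0 < M) (hK : 0 ≤ K)
    (hu : ∀ x ∈ X, 0 ≤ u x ∧ u x ≤ M) (hv : ∀ y ∈ Y, 0 ≤ v y ∧ v y ≤ 1)
    (hU : ∑ x ∈ X, u x ≤ U) (hV : ∑ y ∈ Y, v y ≤ V) (hMK : M * U * V ≤ K ^ 2) :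
    ∑ x ∈ X, u x * ∑ y ∈ Y, v y * F x y ≤ p * V * ∑ x ∈ X, u x + b * K := by
  have h1 := (le_abs_self _).trans (h.bilin_nonneg hb hM one_pos hK hu hv hU hV (by simpa using hMK))
  have e : ∑ x ∈ X, u x * ∑ y ∈ Y, v y * F x y
      = p * (∑ y ∈ Y, v y) * (∑ x ∈ X, u x)
        + ∑ x ∈ X, ∑ y ∈ Y, (F x y - p) * (u x * v y) := by
    rw [mul_assoc, mul_comm (∑ y ∈ Y, v y), sum_mul_sum, mul_sum, ← sum_add_distrib]
    refine sum_congr rfl fun x _ => ?_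
    rw [mul_sum, mul_sum, ← sum_add_distrib]
    exact sum_congr rfl fun y _ => by ring
  rw [e]
  have hu0 : 0 ≤ ∑ x ∈ X, u x := sum_nonneg fun x hx => (hu x hx).1
  have : p * (∑ y ∈ Y, v y) * (∑ x ∈ X, u x) ≤ p * V * ∑ x ∈ X, u x := by gcongr
  linarith

/-- Vertices whose codegree with a given vertex is large account for few common neighbours. -/
theorem Jumbled.large_codegree_sum_le {F : α → β → ℝ} {p c a b : ℝ} {B : Finset α}
    {Y : Finset β} (h : Jumbled F p (c * p ^ 2 * √(a * b)) B Y) (hp : 0 < p) (hc : 0 ≤ c)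
    (ha : 0 ≤ a) (hb : 0 < b) {v : β → ℝ} (hv : ∀ y ∈ Y, 0 ≤ v y ∧ v y ≤ 1)
    (hV : ∑ y ∈ Y, v y ≤ 2 * p * b) (hB : ∀ x ∈ B, 4 * p ^ 2 * b < ∑ y ∈ Y, v y * F x y) :
    ∑ x ∈ B, ∑ y ∈ Y, v y * F x y ≤ 2 * c ^ 2 * p ^ 3 * a * b := by
  set t : ℝ := ((#B : ℕ) : ℝ) with ht
  set J := c * p ^ 2 * √(a * b) with hJ
  have hJ2 : J ^ 2 = c ^ 2 * p ^ 4 * (a * b) := by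
    rw [hJ, mul_pow, Real.sq_sqrt (by positivity)]; ring
  have hJ0 : 0 ≤ J := by positivity
  have h1 := h.sum_le hp.le hJ0 (u := fun _ => 1) (M := 1) (U := t) (K := √(2 * p * b * t))
    one_pos (Real.sqrt_nonneg _) (by simp) hv (by simp [ht]) hV (by
      rw [Real.sq_sqrt (by positivity)]; exact le_of_eq (by ring))
  simp only [one_mul, sum_const, nsmul_eq_mul, mul_one] at h1
  have h2 : t * (4 * p ^ 2 * b) ≤ ∑ x ∈ B, ∑ y ∈ Y, v y * F x y := by
    rw [ht, ← nsmul_eq_mul]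
    exact card_nsmul_le_sum _ _ _ fun x hx => (hB x hx).le
  -- The threshold `4 * p ^ 2 * b` is twice the main term `p * (2 * p * b)`, so half of the excess
  -- must come from the jumbledness error.
  have h3 : 2 * p ^ 2 * b * t ≤ J * √(2 * p * b * t) := by linarith
  have ht0 : 0 ≤ t := Nat.cast_nonneg _
  have h4 : 2 * t ≤ c ^ 2 * p * a := by
    rcases ht0.eq_or_lt with h0 | h0
    · rw [← h0]; simp; positivity
    have h5 := pow_le_pow_left₀ (by positivity) h3 2
    rw [mul_pow J, hJ2, Real.sq_sqrt (by positivity)] at h5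
    have h6 : (2 * p ^ 4 * b ^ 2 * t) * (2 * t) ≤ (2 * p ^ 4 * b ^ 2 * t) * (c ^ 2 * p * a) := by
      linarith
    exact le_of_mul_le_mul_left h6 (by positivity)
  have h7 : √(2 * p * b * t) ≤ c * p * √(a * b) := by
    rw [← Real.sqrt_sq (by positivity : 0 ≤ c * p), ← Real.sqrt_mul (by positivity)]
    apply Real.sqrt_le_sqrt
    nlinarith [mul_le_mul_of_nonneg_left h4 (by positivity : 0 ≤ p * b)]
  have h8 : J * √(2 * p * b * t) ≤ c ^ 2 * p ^ 3 * (a * b) := by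
    refine (mul_le_mul_of_nonneg_left h7 hJ0).trans (le_of_eq ?_)
    rw [hJ]
    linear_combination (c ^ 2 * p ^ 3) * Real.mul_self_sqrt (by positivity : 0 ≤ a * b)
  nlinarith [mul_le_mul_of_nonneg_left h4 (by positivity : 0 ≤ p ^ 2 * b)]

section
variable {g Γ : α → β → ℝ} {p c a b d : ℝ} {X : Finset α} {Y : Finset β} {Z : Finset ζ}

theorem DominatedPair.abs_codegree_le (h : DominatedPair g Γ p c a b X Y) (hp : 0 < p)
    {x x' : α} (hx : x ∈ X) (hx' : x' ∈ X) :
    |∑ y ∈ Y, g x y * g x' y| ≤ ∑ y ∈ Y, Γ x y * Γ x' y + 12 * p ^ 2 * b := by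
  have h1 : |∑ y ∈ Y, g x y * g x' y| ≤ ∑ y ∈ Y, (Γ x y + 2 * p) * (Γ x' y + 2 * p) := by
    refine (abs_sum_le_sum_abs _ _).trans (sum_le_sum fun y hy => ?_)
    rw [abs_mul]
    exact mul_le_mul (h.abs_le x hx y hy) (h.abs_le x' hx' y hy) (abs_nonneg _)
      (by linarith [h.nonneg x hx y hy])
  have e : ∑ y ∈ Y, (Γ x y + 2 * p) * (Γ x' y + 2 * p)
      = ∑ y ∈ Y, Γ x y * Γ x' y + 2 * p * ∑ y ∈ Y, Γ x y + 2 * p * ∑ y ∈ Y, Γ x' y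
        + #Y * (4 * p ^ 2) := by
    rw [← nsmul_eq_mul (#Y), ← sum_const, mul_sum, mul_sum, ← sum_add_distrib, ← sum_add_distrib,
      ← sum_add_distrib]
    exact sum_congr rfl fun y _ => by ring
  nlinarith [mul_le_mul_of_nonneg_left (h.degree_left x hx) hp.le,
    mul_le_mul_of_nonneg_left (h.degree_left x' hx') hp.le,
    mul_le_mul_of_nonneg_right h.card_right (sq_nonneg p)]

/-- With `x` fixed, jumbledness of `Γ'` is tested on the weights `|codegree of g|` and `Γ' x`. The
error depends on the maximum times the sum of the codegrees, so vertices `x'` of large codegree are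
treated apart: their weights may be larger by a factor `1 / p`, but their total is smaller by a
factor `p`. Both parts give an error of order `c * p ^ 4`, which is where the exponent 3/2 of `Γ'`
is used. -/
theorem DominatedPair.weighted_codegree_sum_le_vertex (h : DominatedPair g Γ p c a b X Y)
    (hp : 0 < p) (hc : 0 ≤ c) (hc1 : c ≤ 1) (hb : 0 < b) (hd : 0 ≤ d)
    {Γ' : α → ζ → ℝ} (h0 : ∀ x ∈ X, ∀ z ∈ Z, 0 ≤ Γ' x z ∧ Γ' x z ≤ 1)
    (hdeg : ∀ x ∈ X, ∑ z ∈ Z, Γ' x z ≤ 2 * p * d)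
    (hJ : Jumbled Γ' p (c * (p * √p) * √(a * d)) X Z) {x : α} (hx : x ∈ X) :
    ∑ x' ∈ X, |∑ y ∈ Y, g x y * g x' y| * ∑ z ∈ Z, Γ' x z * Γ' x' z
      ≤ 2 * p ^ 2 * d * ∑ x' ∈ X, |∑ y ∈ Y, g x y * g x' y| + 35 * c * p ^ 4 * a * b * d := by
  classical
  have ha := h.a_nonneg
  set w : α → ℝ := fun x' => |∑ y ∈ Y, g x y * g x' y| with hw
  set k : α → ℝ := fun x' => ∑ y ∈ Y, Γ x y * Γ x' y with hk
  have hw0 : ∀ x', 0 ≤ w x' := fun _ => abs_nonneg _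
  have hwk : ∀ x' ∈ X, w x' ≤ k x' + 12 * p ^ 2 * b := fun x' hx' => h.abs_codegree_le hp hx hx'
  have hJ0 : 0 ≤ c * (p * √p) * √(a * d) := by positivity
  have hprod : ∀ K, c * (p * √p) * √(a * d) * (K * (p ^ 2 * √p * b * √(a * d)))
      = K * c * p ^ 4 * a * b * d := fun K => by
    have e1 := Real.mul_self_sqrt hp.le
    have e2 := Real.mul_self_sqrt (mul_nonneg ha hd)
    calc _ = K * c * p ^ 3 * b * (√p * √p) * (√(a * d) * √(a * d)) := by ring
      _ = _ := by rw [e1, e2]; ring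
  have hsq : ∀ K : ℝ, (K * (p ^ 2 * √p * b * √(a * d))) ^ 2 = K ^ 2 * (p ^ 5 * b ^ 2 * (a * d)) :=
    fun K => by
    have e1 := Real.sq_sqrt hp.le
    have e2 := Real.sq_sqrt (mul_nonneg ha hd)
    calc _ = K ^ 2 * p ^ 4 * b ^ 2 * √p ^ 2 * √(a * d) ^ 2 := by ring
      _ = _ := by rw [e1, e2]; ring
  set B := X.filter fun x' => 4 * p ^ 2 * b < k x' with hB
  set C := X.filter fun x' => ¬ 4 * p ^ 2 * b < k x' with hC
  have hBX : B ⊆ X := filter_subset _ _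
  have hCX : C ⊆ X := filter_subset _ _
  have hkB : ∑ x' ∈ B, k x' ≤ 2 * c ^ 2 * p ^ 3 * a * b :=
    (h.jumbled.mono le_rfl hBX Subset.rfl).large_codegree_sum_le hp hc ha hb
      (fun y hy => ⟨h.nonneg x hx y hy, h.le_one x hx y hy⟩) (h.degree_left x hx)
      fun x' hx' => (mem_filter.1 hx').2
  have hwB : ∀ x' ∈ B, w x' ≤ 4 * k x' := fun x' hx' => by
    have := (mem_filter.1 hx').2
    linarith [hwk x' (hBX hx')]
  have hkmax : ∀ x' ∈ X, k x' ≤ 2 * p * b := fun x' hx' =>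
    (sum_le_sum fun y hy => mul_le_of_le_one_right (h.nonneg x hx y hy)
      (h.le_one x' hx' y hy)).trans (h.degree_left x hx)
  -- Here `M * U * V = 128 * c ^ 2 * p ^ 5 * a * b ^ 2 * d`, and `128 ≤ 12 ^ 2`.
  have sB := (hJ.mono le_rfl hBX Subset.rfl).sum_le hp.le hJ0 (u := w) (v := Γ' x)
    (M := 8 * p * b) (U := 8 * c ^ 2 * p ^ 3 * a * b) (V := 2 * p * d)
    (K := 12 * c * (p ^ 2 * √p * b * √(a * d))) (by positivity) (by positivity)
    (fun x' hx' => ⟨hw0 _, by linarith [hwB x' hx', hkmax x' (hBX hx')]⟩) (h0 x hx)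
    (by
      refine (sum_le_sum hwB).trans ?_
      rw [← mul_sum]; linarith) (hdeg x hx) (by
      rw [hsq]
      have : 0 ≤ c ^ 2 * (p ^ 5 * b ^ 2 * (a * d)) := by positivity
      nlinarith)
  -- Here `M * U * V = 512 * p ^ 5 * a * b ^ 2 * d`, and `512 ≤ 23 ^ 2`. The two errors add up to
  -- `35 = 12 + 23`, using `c ≤ 1`.
  have sC := (hJ.mono le_rfl hCX Subset.rfl).sum_le hp.le hJ0 (u := w) (v := Γ' x)
    (M := 16 * p ^ 2 * b) (U := 16 * p ^ 2 * a * b) (V := 2 * p * d)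
    (K := 23 * (p ^ 2 * √p * b * √(a * d))) (by positivity) (by positivity)
    (fun x' hx' => ⟨hw0 _, by
      have := not_lt.1 (mem_filter.1 hx').2
      linarith [hwk x' (hCX hx')]⟩) (h0 x hx)
    (by
      have : ∀ x' ∈ C, w x' ≤ 16 * p ^ 2 * b := fun x' hx' => by
        have := not_lt.1 (mem_filter.1 hx').2
        linarith [hwk x' (hCX hx')]
      refine (sum_le_sum this).trans ?_
      rw [sum_const, nsmul_eq_mul]
      have h1 : (#C : ℝ) ≤ a := (Nat.cast_le.2 (card_le_card hCX)).trans h.card_left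
      nlinarith [mul_le_mul_of_nonneg_right h1 (by positivity : 0 ≤ 16 * p ^ 2 * b)])
    (hdeg x hx) (by
      rw [hsq]
      have : 0 ≤ p ^ 5 * b ^ 2 * (a * d) := by positivity
      nlinarith)
  rw [hprod] at sB sC
  have split : ∀ f : α → ℝ, ∑ x' ∈ X, f x' = ∑ x' ∈ B, f x' + ∑ x' ∈ C, f x' := fun f =>
    (sum_filter_add_sum_filter_not X _ f).symm
  rw [split, split]
  have : c * (c * p ^ 4 * a * b * d) ≤ 1 * (c * p ^ 4 * a * b * d) := by gcongr
  nlinarith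

theorem DominatedPair.weighted_codegree_sum_le (h : DominatedPair g Γ p c a b X Y)
    (hp : 0 < p) (hc : 0 ≤ c) (hc1 : c ≤ 1) (hb : 0 < b) (hd : 0 ≤ d)
    {Γ' : α → ζ → ℝ} (h0 : ∀ x ∈ X, ∀ z ∈ Z, 0 ≤ Γ' x z ∧ Γ' x z ≤ 1)
    (hdeg : ∀ x ∈ X, ∑ z ∈ Z, Γ' x z ≤ 2 * p * d)
    (hJ : Jumbled Γ' p (c * (p * √p) * √(a * d)) X Z) {δ : ℝ}
    (hcod : ∑ x ∈ X, ∑ x' ∈ X, |∑ y ∈ Y, g x y * g x' y| ≤ δ * p ^ 2 * a ^ 2 * b) :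
    ∑ x ∈ X, ∑ x' ∈ X, |∑ y ∈ Y, g x y * g x' y| * ∑ z ∈ Z, Γ' x z * Γ' x' z
      ≤ (2 * δ + 35 * c) * p ^ 4 * a ^ 2 * b * d := by
  have ha := h.a_nonneg
  refine (sum_le_sum fun x hx =>
    h.weighted_codegree_sum_le_vertex hp hc hc1 hb hd h0 hdeg hJ hx).trans ?_
  rw [sum_add_distrib, ← mul_sum, sum_const, nsmul_eq_mul]
  have h1 := mul_le_mul_of_nonneg_left hcod (by positivity : 0 ≤ 2 * p ^ 2 * d)
  have h2 := mul_le_mul_of_nonneg_right h.card_left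
    (by positivity : 0 ≤ 35 * c * p ^ 4 * a * b * d)
  linarith

/-- The second moment over `Y × Z` of the signed kernel composed with a kernel dominated by
`Γ'`. -/
theorem DominatedPair.sum_sq_comp_le (h : DominatedPair g Γ p c a b X Y)
    (hp : 0 < p) (hc : 0 ≤ c) (hc1 : c ≤ 1) (hb : 0 < b) (hd : 0 ≤ d)
    {Γ' : α → ζ → ℝ} (h0 : ∀ x ∈ X, ∀ z ∈ Z, 0 ≤ Γ' x z ∧ Γ' x z ≤ 1)
    (hdeg : ∀ x ∈ X, ∑ z ∈ Z, Γ' x z ≤ 2 * p * d)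
    (hJ : Jumbled Γ' p (c * (p * √p) * √(a * d)) X Z) {δ : ℝ}
    (hcod : ∑ x ∈ X, ∑ x' ∈ X, |∑ y ∈ Y, g x y * g x' y| ≤ δ * p ^ 2 * a ^ 2 * b)
    {S : α → ζ → ℝ} (hS : ∀ x ∈ X, ∀ z ∈ Z, |S x z| ≤ Γ' x z) :
    ∑ y ∈ Y, ∑ z ∈ Z, (∑ x ∈ X, g x y * S x z) ^ 2
      ≤ (2 * δ + 35 * c) * p ^ 4 * a ^ 2 * b * d := by
  refine le_trans ?_ (h.weighted_codegree_sum_le hp hc hc1 hb hd h0 hdeg hJ hcod)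
  -- Expanding the square and summing over `y` and `z` first separates the two codegrees.
  have e : ∑ y ∈ Y, ∑ z ∈ Z, (∑ x ∈ X, g x y * S x z) ^ 2
      = ∑ x ∈ X, ∑ x' ∈ X, (∑ y ∈ Y, g x y * g x' y) * ∑ z ∈ Z, S x z * S x' z := by
    simp_rw [sq, sum_mul_sum]
    symm
    rw [sum_rotate]
    refine sum_congr rfl fun y _ => ?_
    rw [sum_rotate]
    refine sum_congr rfl fun z _ => sum_congr rfl fun x _ => sum_congr rfl fun x' _ => ?_
    ring
  rw [e]
  refine sum_le_sum fun x hx => sum_le_sum fun x' hx' => ?_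
  refine (le_abs_self _).trans ?_
  rw [abs_mul]
  refine mul_le_mul_of_nonneg_left ?_ (abs_nonneg _)
  refine (abs_sum_le_sum_abs _ _).trans (sum_le_sum fun z hz => ?_)
  rw [abs_mul]
  exact mul_le_mul (hS x hx z hz) (hS x' hx' z hz) (abs_nonneg _) (h0 x hx z hz).1

end

/-! ### Compositions, triangle sums, and discarding exceptional vertices -/

section
variable {g Γ : α → β → ℝ} {p c a b d : ℝ} {X : Finset α} {Y : Finset β} {Z : Finset ζ}

theorem DominatedPair.sum_abs_comp_le (h : DominatedPair g Γ p c a b X Y)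
    (hp : 0 < p) (hc : 0 ≤ c) (hc1 : c ≤ 1) (hb : 0 < b) (hd : #Z ≤ d)
    {Γ' : α → ζ → ℝ} (h0 : ∀ x ∈ X, ∀ z ∈ Z, 0 ≤ Γ' x z ∧ Γ' x z ≤ 1)
    (hdeg : ∀ x ∈ X, ∑ z ∈ Z, Γ' x z ≤ 2 * p * d)
    (hJ : Jumbled Γ' p (c * (p * √p) * √(a * d)) X Z) {δ η : ℝ} (hη : 0 ≤ η)
    (hcod : ∑ x ∈ X, ∑ x' ∈ X, |∑ y ∈ Y, g x y * g x' y| ≤ δ * p ^ 2 * a ^ 2 * b)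
    {S : α → ζ → ℝ} (hS : ∀ x ∈ X, ∀ z ∈ Z, |S x z| ≤ Γ' x z)
    (hδη : 2 * δ + 35 * c ≤ η ^ 2) :
    ∑ y ∈ Y, ∑ z ∈ Z, |∑ x ∈ X, g x y * S x z| ≤ η * p ^ 2 * a * b * d := by
  have ha := h.a_nonneg
  have hd0 : 0 ≤ d := (Nat.cast_nonneg _).trans hd
  have h1 := h.sum_sq_comp_le hp hc hc1 hb hd0 h0 hdeg hJ hcod hS
  have h2 := sq_sum_mul_le_of_abs_le (s := Y ×ˢ Z) (f := fun _ => 1) (w := fun _ => 1)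
    (h := fun q => |∑ x ∈ X, g x q.1 * S x q.2|) (by simp)
  simp only [one_mul, sq_abs, sum_product, sum_const, nsmul_eq_mul, mul_one, card_product, Nat.cast_mul] at h2
  refine abs_le_of_sq_le_sq' ?_ (by positivity) |>.2
  refine h2.trans ?_
  calc _ ≤ (b * d) * ((2 * δ + 35 * c) * p ^ 4 * a ^ 2 * b * d) := by
        refine mul_le_mul (mul_le_mul h.card_right hd (Nat.cast_nonneg _) hb.le) h1
          (sum_nonneg fun _ _ => sum_nonneg fun _ _ => sq_nonneg _) (by positivity)
    _ = (2 * δ + 35 * c) * (p ^ 2 * a * b * d) ^ 2 := by ring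
    _ ≤ η ^ 2 * (p ^ 2 * a * b * d) ^ 2 := by gcongr
    _ = _ := by ring

/-- Unweighted Cauchy–Schwarz would lose the factor `p` carried by the sparse kernel `T`, so the
weight `Γ''` is used. The composition of `g` and `S` is a sum of rank-one kernels indexed by `x`,
hence `Γ''` can be replaced by `p` in its weighted second moment; the error is of the right order `c
* p ^ 5` because `Γ''` has exponent 3. -/
theorem DominatedPair.abs_sum_triangle_le (h : DominatedPair g Γ p c a b X Y)
    (hp : 0 < p) (hp1 : p ≤ 1) (hc : 0 ≤ c) (hc1 : c ≤ 1) (hb : 0 < b) (hd : #Z ≤ d)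
    {Γ' : α → ζ → ℝ} (h0 : ∀ x ∈ X, ∀ z ∈ Z, 0 ≤ Γ' x z ∧ Γ' x z ≤ 1)
    (hdeg : ∀ x ∈ X, ∑ z ∈ Z, Γ' x z ≤ 2 * p * d)
    (hdegZ : ∀ z ∈ Z, ∑ x ∈ X, Γ' x z ≤ 2 * p * a)
    (hJ : Jumbled Γ' p (c * (p * √p) * √(a * d)) X Z)
    {Γ'' : β → ζ → ℝ} (h0' : ∀ y ∈ Y, ∀ z ∈ Z, 0 ≤ Γ'' y z ∧ Γ'' y z ≤ 1)
    (hdeg' : ∀ z ∈ Z, ∑ y ∈ Y, Γ'' y z ≤ 2 * p * b)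
    (hJ' : Jumbled Γ'' p (c * p ^ 3 * √(b * d)) Y Z) {δ η : ℝ} (hη : 0 ≤ η)
    (hcod : ∑ x ∈ X, ∑ x' ∈ X, |∑ y ∈ Y, g x y * g x' y| ≤ δ * p ^ 2 * a ^ 2 * b)
    {S : α → ζ → ℝ} (hS : ∀ x ∈ X, ∀ z ∈ Z, |S x z| ≤ Γ' x z)
    {T : β → ζ → ℝ} (hT : ∀ y ∈ Y, ∀ z ∈ Z, |T y z| ≤ Γ'' y z)
    (hδη : 4 * δ + 262 * c ≤ η ^ 2) :
    ∑ y ∈ Y, ∑ z ∈ Z, T y z * ∑ x ∈ X, g x y * S x z ≤ η * p ^ 3 * a * b * d := by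
  have ha := h.a_nonneg
  have hd0 : 0 ≤ d := (Nat.cast_nonneg _).trans hd
  have h1 := h.sum_sq_comp_le hp hc hc1 hb hd0 h0 hdeg hJ hcod hS
  have hZ2 : ∑ z ∈ Z, (∑ x ∈ X, |S x z|) ^ 2 ≤ 4 * p ^ 2 * a ^ 2 * d := by
    calc ∑ z ∈ Z, (∑ x ∈ X, |S x z|) ^ 2 ≤ ∑ z ∈ Z, (2 * p * a) ^ 2 :=
          sum_le_sum fun z hz => pow_le_pow_left₀ (sum_nonneg fun _ _ => abs_nonneg _)
            ((sum_le_sum fun x hx => hS x hx z hz).trans (hdegZ z hz)) 2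
      _ ≤ 4 * p ^ 2 * a ^ 2 * d := by
          rw [sum_const, nsmul_eq_mul]
          nlinarith [hd, sq_nonneg (p * a)]
  have h2 := hJ'.sum_mul_sq_le (by positivity) (s := X) (u := fun x y => g x y)
    (v := fun x z => S x z) (M := 3) (N := 1) (K := 8 * p ^ 2 * a ^ 2 * √(b * d))
    three_pos one_pos (by positivity) (fun i hi j hj => h.abs_le_three hp1 hi hj)
    (fun i hi j hj => (hS i hi j hj).trans (h0 i hi j hj).2) (by
      rw [mul_pow, Real.sq_sqrt (by positivity)]
      exact (mul_le_mul (h.sum_sq_right hp) hZ2 (sum_nonneg fun _ _ => sq_nonneg _)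
        (by positivity)).trans (le_of_eq (by ring)))
  have h3 : ∑ y ∈ Y, ∑ z ∈ Z, Γ'' y z * (∑ x ∈ X, g x y * S x z) ^ 2
      ≤ (2 * δ + 131 * c) * p ^ 5 * a ^ 2 * b * d := by
    have e2 : 4 * (c * p ^ 3 * √(b * d)) * 3 * 1 * (8 * p ^ 2 * a ^ 2 * √(b * d))
        = 96 * c * p ^ 5 * a ^ 2 * b * d := by
      linear_combination (96 * c * p ^ 5 * a ^ 2) * Real.mul_self_sqrt (mul_nonneg hb.le hd0)
    rw [e2] at h2
    linarith [mul_le_mul_of_nonneg_left h1 hp.le]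
  have h4 : ∑ y ∈ Y, ∑ z ∈ Z, Γ'' y z ≤ 2 * p * b * d := by
    rw [sum_comm]
    calc ∑ z ∈ Z, ∑ y ∈ Y, Γ'' y z ≤ ∑ z ∈ Z, 2 * p * b := sum_le_sum hdeg'
      _ ≤ 2 * p * b * d := by
          rw [sum_const, nsmul_eq_mul, mul_comm]
          gcongr
  have h5 := sq_sum_mul_le_of_abs_le (s := Y ×ˢ Z) (f := fun q => T q.1 q.2)
    (w := fun q => Γ'' q.1 q.2) (h := fun q => ∑ x ∈ X, g x q.1 * S x q.2)
    (fun q hq => hT _ (mem_product.1 hq).1 _ (mem_product.1 hq).2)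
  rw [sum_product, sum_product, sum_product] at h5
  refine abs_le_of_sq_le_sq' ?_ (by positivity) |>.2
  refine h5.trans ?_
  calc _ ≤ (2 * p * b * d) * ((2 * δ + 131 * c) * p ^ 5 * a ^ 2 * b * d) := by
        refine mul_le_mul h4 h3 ?_ (by positivity)
        exact sum_nonneg fun y hy => sum_nonneg fun z hz =>
          mul_nonneg (h0' y hy z hz).1 (sq_nonneg _)
    _ = (4 * δ + 262 * c) * (p ^ 3 * a * b * d) ^ 2 := by ring
    _ ≤ η ^ 2 * (p ^ 3 * a * b * d) ^ 2 := by gcongr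
    _ = _ := by ring

/-- Few vertices have more than twice the expected degree. -/
theorem Jumbled.card_large_degree_le {F : α → β → ℝ} {J : ℝ} (h : Jumbled F p J X Y)
    (hp : 0 < p) {B : Finset α} (hBX : B ⊆ X)
    (hB : ∀ x ∈ B, 2 * p * (#Y : ℝ) < ∑ y ∈ Y, F x y) : (#B : ℝ) * (p ^ 2 * #Y) ≤ J ^ 2 := by
  have h1 := (le_abs_self _).trans (h B hBX Y Subset.rfl)
  simp only [sum_sub_distrib, sum_const, nsmul_eq_mul] at h1
  have h2 : (#B : ℝ) * (2 * p * #Y) ≤ ∑ x ∈ B, ∑ y ∈ Y, F x y := by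
    rw [← nsmul_eq_mul]
    exact card_nsmul_le_sum _ _ _ fun x hx => (hB x hx).le
  set t : ℝ := ((#B : ℕ) : ℝ)
  set s : ℝ := ((#Y : ℕ) : ℝ)
  have ht0 : 0 ≤ t := Nat.cast_nonneg _
  have hs0 : 0 ≤ s := Nat.cast_nonneg _
  have h3 : p * (t * s) ≤ J * √(t * s) := by linarith
  rcases (mul_nonneg ht0 hs0).eq_or_lt with h0 | h0
  · calc t * (p ^ 2 * s) = p ^ 2 * (t * s) := by ring
      _ ≤ J ^ 2 := by rw [← h0, mul_zero]; positivity
  have h4 := pow_le_pow_left₀ (by positivity) h3 2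
  rw [mul_pow J, Real.sq_sqrt (by positivity)] at h4
  exact le_of_mul_le_mul_right (by linarith : t * (p ^ 2 * s) * (t * s) ≤ J ^ 2 * (t * s)) h0

theorem Jumbled.sum_abs_le {J s t : ℝ} (h : Jumbled Γ p J X Y) (hp : 0 < p) (hJ : 0 ≤ J)
    (hg : ∀ x ∈ X, ∀ y ∈ Y, |g x y| ≤ Γ x y + 2 * p) {A : Finset α} {B : Finset β}
    (hA : A ⊆ X) (hB : B ⊆ Y) (hs : #A ≤ s) (ht : #B ≤ t) :
    ∑ x ∈ A, ∑ y ∈ B, |g x y| ≤ 3 * p * s * t + J * √(s * t) := by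
  have h1 := (le_abs_self _).trans (h A hA B hB)
  have hs0 : 0 ≤ s := (Nat.cast_nonneg _).trans hs
  have ht0 : 0 ≤ t := (Nat.cast_nonneg _).trans ht
  have h2 : ∑ x ∈ A, ∑ y ∈ B, |g x y| ≤ ∑ x ∈ A, ∑ y ∈ B, ((Γ x y - p) + 3 * p) :=
    sum_le_sum fun x hx => sum_le_sum fun y hy => by linarith [hg x (hA hx) y (hB hy)]
  refine h2.trans ?_
  simp_rw [sum_add_distrib (g := fun _ => 3 * p), sum_add_distrib, sum_const, nsmul_eq_mul]
  have h3 : (#A : ℝ) * (#B * (3 * p)) ≤ 3 * p * s * t := by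
    calc (#A : ℝ) * (#B * (3 * p)) = 3 * p * (#A * #B) := by ring
      _ ≤ 3 * p * (s * t) := by gcongr
      _ = _ := by ring
  have h4 : J * √((#A : ℝ) * #B) ≤ J * √(s * t) := by gcongr
  linarith

/-- Discarding small sets of exceptional vertices changes sums of a dominated kernel little. -/
theorem Jumbled.abs_sum_le_discard [DecidableEq α] [DecidableEq β] {μ : ℝ}
    (h : Jumbled Γ p (c * p ^ 2 * √((#X : ℝ) * #Y)) X Y)
    (hp : 0 < p) (hp1 : p ≤ 1) (hc : 0 ≤ c) (hμ : p ≤ μ)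
    (hg : ∀ x ∈ X, ∀ y ∈ Y, |g x y| ≤ Γ x y + 2 * p) {X' : Finset α} {Y' : Finset β}
    (hX' : (#(X \ X') : ℝ) ≤ 2 * c ^ 2 * p * #X)
    (hY' : (#(Y \ Y') : ℝ) ≤ c ^ 2 * p ^ 2 * #Y) {A : Finset α} {B : Finset β}
    (hA : A ⊆ X) (hB : B ⊆ Y) (hAμ : #A ≤ μ * #X) (hBμ : #B ≤ μ * #Y) :
    |∑ x ∈ A, ∑ y ∈ B, g x y|
      ≤ |∑ x ∈ A ∩ X', ∑ y ∈ B ∩ Y', g x y| + 12 * c ^ 2 * p ^ 2 * μ * #X * #Y := by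
  have hμ0 : 0 < μ := hp.trans_le hμ
  have hJ : 0 ≤ c * p ^ 2 * √((#X : ℝ) * #Y) := by positivity
  have h1 := h.sum_abs_le hp hJ hg (sdiff_subset.trans hA : A \ X' ⊆ X) hB
    ((Nat.cast_le.2 (card_le_card (sdiff_subset_sdiff hA Subset.rfl))).trans hX') hBμ
  have h2 := h.sum_abs_le hp hJ hg hA (sdiff_subset.trans hB : B \ Y' ⊆ Y) hAμ
    ((Nat.cast_le.2 (card_le_card (sdiff_subset_sdiff hB Subset.rfl))).trans hY')
  set a : ℝ := ((#X : ℕ) : ℝ)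
  set b : ℝ := ((#Y : ℕ) : ℝ)
  have ha : 0 ≤ a := Nat.cast_nonneg _
  have hb : 0 ≤ b := Nat.cast_nonneg _
  -- With `p ≤ μ` the small exceptional sets compensate the square root, so every loss is
  -- proportional to `μ`. This matters when `A` and `B` lie in neighbourhoods and `μ = 2 * p`.
  have r1 : √(2 * c ^ 2 * p * a * (μ * b)) ≤ 2 * c * μ * √(a * b) := by
    rw [← Real.sqrt_sq (by positivity : 0 ≤ 2 * c * μ), ← Real.sqrt_mul (by positivity)]
    apply Real.sqrt_le_sqrt
    nlinarith [mul_le_mul_of_nonneg_left hμ (by positivity : 0 ≤ c ^ 2 * μ * (a * b)),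
      (by positivity : 0 ≤ c ^ 2 * μ ^ 2 * (a * b))]
  have r2 : √(μ * a * (c ^ 2 * p ^ 2 * b)) ≤ c * μ * √(a * b) := by
    rw [← Real.sqrt_sq (by positivity : 0 ≤ c * μ), ← Real.sqrt_mul (by positivity)]
    apply Real.sqrt_le_sqrt
    have : p ^ 2 ≤ μ := by nlinarith
    nlinarith [mul_le_mul_of_nonneg_left this (by positivity : 0 ≤ c ^ 2 * μ * (a * b))]
  have q := Real.mul_self_sqrt (mul_nonneg ha hb)
  have r1' : c * p ^ 2 * √(a * b) * √(2 * c ^ 2 * p * a * (μ * b))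
      ≤ 2 * c ^ 2 * p ^ 2 * μ * (a * b) := by
    refine (mul_le_mul_of_nonneg_left r1 hJ).trans (le_of_eq ?_)
    linear_combination (2 * c ^ 2 * p ^ 2 * μ) * q
  have r2' : c * p ^ 2 * √(a * b) * √(μ * a * (c ^ 2 * p ^ 2 * b))
      ≤ c ^ 2 * p ^ 2 * μ * (a * b) := by
    refine (mul_le_mul_of_nonneg_left r2 hJ).trans (le_of_eq ?_)
    linear_combination (c ^ 2 * p ^ 2 * μ) * q
  have r3 : p * (c ^ 2 * p ^ 2 * μ * (a * b)) ≤ 1 * (c ^ 2 * p ^ 2 * μ * (a * b)) := by gcongr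
  have e : ∑ x ∈ A, ∑ y ∈ B, g x y = ∑ x ∈ A ∩ X', ∑ y ∈ B ∩ Y', g x y
      + ∑ x ∈ A ∩ X', ∑ y ∈ B \ Y', g x y + ∑ x ∈ A \ X', ∑ y ∈ B, g x y := by
    rw [← sum_add_distrib, ← sum_inter_add_sum_sdiff A X']
    congr 1
    exact sum_congr rfl fun x _ => (sum_inter_add_sum_sdiff B Y' _).symm
  have i1 : |∑ x ∈ A ∩ X', ∑ y ∈ B \ Y', g x y| ≤ ∑ x ∈ A, ∑ y ∈ B \ Y', |g x y| := by
    refine (abs_sum_le_sum_abs _ _).trans ((sum_le_sum fun x _ => abs_sum_le_sum_abs _ _).trans ?_)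
    exact sum_le_sum_of_subset_of_nonneg inter_subset_left
      fun _ _ _ => sum_nonneg fun _ _ => abs_nonneg _
  have i2 : |∑ x ∈ A \ X', ∑ y ∈ B, g x y| ≤ ∑ x ∈ A \ X', ∑ y ∈ B, |g x y| :=
    (abs_sum_le_sum_abs _ _).trans (sum_le_sum fun x _ => abs_sum_le_sum_abs _ _)
  rw [e]
  refine (abs_add_three _ _ _).trans ?_
  linarith

end

/-! ### Inheritance of cut-closeness by neighbourhoods -/

section
variable {g Γ : α → β → ℝ} {p c : ℝ} {X : Finset α} {Y : Finset β} {Z : Finset ζ}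
  {Γ' : α → ζ → ℝ} {Γ'' : β → ζ → ℝ}

/-- The assumptions on the pairs `(X, Y)` and `(X, Z)` under which regularity is inherited. -/
structure InheritancePair (g Γ : α → β → ℝ) (Γ' : α → ζ → ℝ) (p c : ℝ) (X : Finset α)
    (Y : Finset β) (Z : Finset ζ) : Prop where
  unit : ∀ x y, 0 ≤ Γ x y ∧ Γ x y ≤ 1
  unit' : ∀ x z, 0 ≤ Γ' x z ∧ Γ' x z ≤ 1
  abs_le : ∀ x y, |g x y| ≤ Γ x y + 2 * p
  jumbled : Jumbled Γ p (c * p ^ 2 * √((#X : ℝ) * #Y)) X Y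
  jumbled' : Jumbled Γ' p (c * (p * √p) * √((#X : ℝ) * #Z)) X Z
  cut : CutClose g (c * p * #X * #Y) X Y
  right_nonempty : Y.Nonempty
  apex_nonempty : Z.Nonempty

/-- There are large subsets of `X` and `Y` without vertices of large degree. -/
theorem InheritancePair.exists_dominated (h : InheritancePair g Γ Γ' p c X Y Z) (hp : 0 < p)
    (hp1 : p ≤ 1) (hX : X.Nonempty) :
    ∃ X' ⊆ X, ∃ Y' ⊆ Y, DominatedPair g Γ p c #X #Y X' Y' ∧
      (∀ x ∈ X', ∑ z ∈ Z, Γ' x z ≤ 2 * p * #Z) ∧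
      (∀ A : Finset α, A ⊆ X → (∀ x ∈ A, x ∉ X') → (#A : ℝ) ≤ 2 * c ^ 2 * p * #X) ∧
      (∀ B : Finset β, B ⊆ Y → (∀ y ∈ B, y ∉ Y') → (#B : ℝ) ≤ c ^ 2 * p ^ 2 * #Y) := by
  classical
  have ha : (0 : ℝ) < #X := Nat.cast_pos.2 hX.card_pos
  have hb : (0 : ℝ) < #Y := Nat.cast_pos.2 h.right_nonempty.card_pos
  have hd : (0 : ℝ) < #Z := Nat.cast_pos.2 h.apex_nonempty.card_pos
  refine ⟨X.filter fun x => ∑ y ∈ Y, Γ x y ≤ 2 * p * #Y ∧ ∑ z ∈ Z, Γ' x z ≤ 2 * p * #Z,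
    filter_subset _ _, Y.filter fun y => ∑ x ∈ X, Γ x y ≤ 2 * p * #X, filter_subset _ _,
    ?_, ?_, ?_, ?_⟩
  · exact
    { card_left := Nat.cast_le.2 (card_le_card (filter_subset _ _))
      card_right := Nat.cast_le.2 (card_le_card (filter_subset _ _))
      nonneg := fun x _ y _ => (h.unit x y).1
      le_one := fun x _ y _ => (h.unit x y).2
      abs_le := fun x _ y _ => h.abs_le x y
      degree_left := fun x hx => (sum_le_sum_of_subset_of_nonneg (filter_subset _ _)
        fun y _ _ => (h.unit x y).1).trans (mem_filter.1 hx).2.1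
      degree_right := fun y hy => (sum_le_sum_of_subset_of_nonneg (filter_subset _ _)
        fun x _ _ => (h.unit x y).1).trans (mem_filter.1 hy).2
      jumbled := h.jumbled.mono le_rfl (filter_subset _ _) (filter_subset _ _) }
  · exact fun x hx => (mem_filter.1 hx).2.2
  · intro A hA hA'
    have h1 := h.jumbled.card_large_degree_le hp
      (B := A.filter fun x => 2 * p * #Y < ∑ y ∈ Y, Γ x y)
      ((filter_subset _ _).trans hA) fun x hx => (mem_filter.1 hx).2
    have h2 := h.jumbled'.card_large_degree_le hp
      (B := A.filter fun x => 2 * p * #Z < ∑ z ∈ Z, Γ' x z)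
      ((filter_subset _ _).trans hA) fun x hx => (mem_filter.1 hx).2
    have hsub : A ⊆ (A.filter fun x => 2 * p * #Y < ∑ y ∈ Y, Γ x y) ∪
        A.filter fun x => 2 * p * #Z < ∑ z ∈ Z, Γ' x z := fun x hx => by
      by_contra hn
      simp only [mem_union, mem_filter, not_or, not_and, not_lt] at hn
      exact hA' x hx (mem_filter.2 ⟨hA hx, hn.1 hx, hn.2 hx⟩)
    have h3 : (#A : ℝ) ≤ #(A.filter fun x => 2 * p * #Y < ∑ y ∈ Y, Γ x y)
        + #(A.filter fun x => 2 * p * #Z < ∑ z ∈ Z, Γ' x z) := by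
      exact_mod_cast (card_le_card hsub).trans (card_union_le _ _)
    rw [mul_pow, Real.sq_sqrt (by positivity)] at h1 h2
    have e1 : (c * (p * √p)) ^ 2 = c ^ 2 * p ^ 3 := by
      rw [mul_pow, mul_pow, Real.sq_sqrt hp.le]; ring
    rw [e1] at h2
    -- Exponent 2 of `Γ` leaves at most `c ^ 2 * p ^ 2 * #X` vertices of large degree, exponent 3/2
    -- of `Γ'` at most `c ^ 2 * p * #X`.
    have h1' := le_of_mul_le_mul_right
      (h1.trans_eq (by ring : _ = (c ^ 2 * p ^ 2 * #X) * (p ^ 2 * (#Y : ℝ)))) (by positivity)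
    have h2' := le_of_mul_le_mul_right
      (h2.trans_eq (by ring : _ = (c ^ 2 * p * #X) * (p ^ 2 * (#Z : ℝ)))) (by positivity)
    have : p * (c ^ 2 * p * #X) ≤ 1 * (c ^ 2 * p * #X) := by gcongr
    linarith
  · intro B hB hB'
    have h1 := h.jumbled.swap.card_large_degree_le hp hB fun y hy => by
      have := hB' y hy
      rw [mem_filter, not_and, not_le] at this
      exact this (hB hy)
    rw [mul_pow, Real.sq_sqrt (by positivity)] at h1
    exact le_of_mul_le_mul_right
      (h1.trans_eq (by ring : _ = (c ^ 2 * p ^ 2 * #Y) * (p ^ 2 * (#X : ℝ)))) (by positivity)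

open Classical in
/-- One-sided inheritance: most vertices `z` have a neighbourhood `N(z)` in `X` such that
`(N(z), Y)` is cut-close. -/
theorem InheritancePair.one_sided (h : InheritancePair g Γ Γ' p c X Y Z) (hp : 0 < p)
    (hp1 : p ≤ 1) (hc : 0 < c) {δ : ℝ} (hδ : 0 < δ) (hδ1 : δ ≤ 1) (hcδ : c ≤ δ ^ 8 / 2 ^ 23) :
    (#(Z.filter fun z => ¬ CutClose g (δ * p ^ 2 * #X * #Y) (X.filter fun x => 1 ≤ Γ' x z) Y) : ℝ)
      ≤ δ * #Z := by
  rcases X.eq_empty_or_nonempty with rfl | hX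
  · rw [filter_false_of_mem, card_empty]
    · simp only [Nat.cast_zero]; positivity
    · intro z _ hz
      refine hz fun A hA B _ => ?_
      have : A = ∅ := by simpa using hA
      simp [this]
  have ha : (0 : ℝ) < #X := Nat.cast_pos.2 hX.card_pos
  have hb : (0 : ℝ) < #Y := Nat.cast_pos.2 h.right_nonempty.card_pos
  have hd : (0 : ℝ) < #Z := Nat.cast_pos.2 h.apex_nonempty.card_pos
  have hδ4 : δ ^ 4 ≤ 1 := pow_le_one₀ hδ.le hδ1
  have hδ8 : δ ^ 8 ≤ δ ^ 4 := by nlinarith [pow_pos hδ 4]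
  have hδ41 : δ ^ 4 ≤ δ := by
    have : δ ^ 3 ≤ 1 := pow_le_one₀ hδ.le hδ1
    nlinarith
  have hc1 : c ≤ 1 := by norm_num at hcδ; linarith
  obtain ⟨X', hX', Y', hY', hdom, hdeg, hXa, hYa⟩ := h.exists_dominated hp hp1 hX
  -- The inequality to check is `192 * (2 * c) ≤ (δ ^ 4 / 128) ^ 2 = δ ^ 8 / 2 ^ 14`, which explains
  -- the power `2 ^ 23` in `hcδ`.
  have hcod := hdom.codegree_sum_le (ε := c) (δ := δ ^ 4 / 128) hp hp1 hc.le (by positivity)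
    (h.cut.mono le_rfl hX' hY') (by norm_num at hcδ; nlinarith)
  set Zb := Z.filter fun z =>
    ¬ CutClose g (δ * p ^ 2 * #X * #Y) (X.filter fun x => 1 ≤ Γ' x z) Y with hZb
  have hbad : ∀ z ∈ Zb, ∃ A ⊆ X.filter (fun x => 1 ≤ Γ' x z), ∃ B ⊆ Y,
      δ * p ^ 2 * #X * #Y < |∑ x ∈ A, ∑ y ∈ B, g x y| := fun z hz => by
    have := (mem_filter.1 hz).2
    simpa only [CutClose, not_forall, not_le, exists_prop] using this
  choose! A hA B hB hAB using hbad
  -- Witness sets for different bad apices are collected in one kernel. It is dominated by `Γ'`,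
  -- since `Γ'` is at least 1 on each witness set.
  set S : α → ζ → ℝ := fun x z => if z ∈ Zb ∧ x ∈ A z then 1 else 0 with hS
  have hSΓ : ∀ x ∈ X', ∀ z ∈ Z, |S x z| ≤ Γ' x z := fun x _ z _ => by
    simp only [hS]
    split_ifs with hz
    · rw [abs_one]; exact (mem_filter.1 (hA z hz.1 hz.2)).2
    · rw [abs_zero]; exact (h.unit' x z).1
  have hcore := hdom.sum_abs_comp_le (δ := δ ^ 4 / 128) (η := δ ^ 2 / 2) hp hc.le hc1 hb le_rfl
    (fun x _ z _ => h.unit' x z) hdeg (h.jumbled'.mono le_rfl hX' Subset.rfl) (by positivity)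
    hcod hSΓ (by norm_num at hcδ; nlinarith [pow_pos hδ 4])
  have hZ : ∀ z ∈ Zb, δ / 2 * p ^ 2 * #X * #Y ≤ ∑ y ∈ Y', |∑ x ∈ X', g x y * S x z| := by
    intro z hz
    have hAX := (hA z hz).trans (filter_subset _ _)
    have h1 := h.jumbled.abs_sum_le_discard (μ := 1) hp hp1 hc.le hp1
      (fun x _ y _ => h.abs_le x y)
      (hXa _ sdiff_subset fun x hx => (mem_sdiff.1 hx).2)
      (hYa _ sdiff_subset fun x hx => (mem_sdiff.1 hx).2) hAX (hB z hz)
      (by rw [one_mul]; exact Nat.cast_le.2 (card_le_card hAX))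
      (by rw [one_mul]; exact Nat.cast_le.2 (card_le_card (hB z hz)))
    have h2 : |∑ x ∈ A z ∩ X', ∑ y ∈ B z ∩ Y', g x y| ≤ ∑ y ∈ Y', |∑ x ∈ X', g x y * S x z| := by
      rw [sum_comm]
      refine (abs_sum_le_sum_abs _ _).trans ?_
      refine (sum_le_sum_of_subset_of_nonneg inter_subset_right
        fun _ _ _ => abs_nonneg _).trans_eq ?_
      refine sum_congr rfl fun y _ => ?_
      congr 1
      simp only [hS, hz, true_and, mul_ite, mul_one, mul_zero]
      rw [← sum_filter, filter_mem_eq_inter, inter_comm]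
    have h3 := hAB z hz
    have h4 : 12 * c ^ 2 ≤ δ / 2 := by norm_num at hcδ; nlinarith
    have h5 : 12 * c ^ 2 * (p ^ 2 * #X * #Y) ≤ δ / 2 * (p ^ 2 * #X * #Y) := by gcongr
    linarith
  -- Each bad `z` contributes at least `δ / 2 * p ^ 2 * #X * #Y` to a sum bounded by `hcore`.
  have h6 : (#Zb : ℝ) * (δ / 2 * p ^ 2 * #X * #Y) ≤ δ ^ 2 / 2 * p ^ 2 * #X * #Y * #Z := by
    refine le_trans ?_ hcore
    rw [sum_comm, ← nsmul_eq_mul]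
    refine (card_nsmul_le_sum _ _ _ hZ).trans ?_
    exact sum_le_sum_of_subset_of_nonneg (filter_subset _ _)
      fun _ _ _ => sum_nonneg fun _ _ => abs_nonneg _
  exact le_of_mul_le_mul_right (h6.trans_eq
    (by ring : _ = (δ * #Z) * (δ / 2 * p ^ 2 * #X * (#Y : ℝ)))) (by positivity)

set_option maxHeartbeats 1000000 in
open Classical in
/-- Two-sided inheritance: most vertices `z` have neighbourhoods in `X` and `Y` which form a
cut-close pair. -/
theorem InheritancePair.two_sided (h : InheritancePair g Γ Γ' p c X Y Z) (hp : 0 < p)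
    (hp1 : p ≤ 1) (hc : 0 < c) {δ : ℝ} (hδ : 0 < δ) (hδ1 : δ ≤ 1) (hcδ : c ≤ δ ^ 8 / 2 ^ 23)
    (h0 : ∀ y z, 0 ≤ Γ'' y z ∧ Γ'' y z ≤ 1)
    (hJ : Jumbled Γ'' p (c * p ^ 3 * √((#Y : ℝ) * #Z)) Y Z) :
    (#(Z.filter fun z => ¬ CutClose g (δ * p ^ 3 * #X * #Y)
      (X.filter fun x => 1 ≤ Γ' x z) (Y.filter fun y => 1 ≤ Γ'' y z)) : ℝ) ≤ δ * #Z := by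
  rcases X.eq_empty_or_nonempty with rfl | hX
  · rw [filter_false_of_mem, card_empty]
    · simp only [Nat.cast_zero]; positivity
    · intro z _ hz
      refine hz fun A hA B _ => ?_
      have : A = ∅ := by simpa using hA
      simp [this]
  have ha : (0 : ℝ) < #X := Nat.cast_pos.2 hX.card_pos
  have hb : (0 : ℝ) < #Y := Nat.cast_pos.2 h.right_nonempty.card_pos
  have hd : (0 : ℝ) < #Z := Nat.cast_pos.2 h.apex_nonempty.card_pos
  have hδ4 : δ ^ 4 ≤ 1 := pow_le_one₀ hδ.le hδ1
  have hδ8 : δ ^ 8 ≤ δ ^ 4 := by nlinarith [pow_pos hδ 4]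
  have hδ41 : δ ^ 4 ≤ δ := by
    have : δ ^ 3 ≤ 1 := pow_le_one₀ hδ.le hδ1
    nlinarith
  have hc1 : c ≤ 1 := by norm_num at hcδ; linarith
  obtain ⟨X', hX', Y', hY', hdom, hdeg, hXa, hYa⟩ := h.exists_dominated hp hp1 hX
  have hcod := hdom.codegree_sum_le (ε := c) (δ := δ ^ 4 / 128) hp hp1 hc.le (by positivity)
    (h.cut.mono le_rfl hX' hY') (by norm_num at hcδ; nlinarith)
  set Z₁ := Z.filter fun z => 2 * p * #X < ∑ x ∈ X, Γ' x z with hZ₁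
  set Z₂ := Z.filter fun z => 2 * p * #Y < ∑ y ∈ Y, Γ'' y z with hZ₂
  -- Apices of large degree into `X` or `Y` are few and are removed first, as the triangle bound
  -- needs degrees of order `p` at the apices.
  set Z' := Z.filter fun z => ∑ x ∈ X, Γ' x z ≤ 2 * p * #X ∧ ∑ y ∈ Y, Γ'' y z ≤ 2 * p * #Y
    with hZ'
  have hZ'Z : Z' ⊆ Z := filter_subset _ _
  set Zb := Z'.filter fun z => ¬ CutClose g (δ * p ^ 3 * #X * #Y)
      (X.filter fun x => 1 ≤ Γ' x z) (Y.filter fun y => 1 ≤ Γ'' y z) with hZb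
  have hcover : (Z.filter fun z => ¬ CutClose g (δ * p ^ 3 * #X * #Y)
      (X.filter fun x => 1 ≤ Γ' x z) (Y.filter fun y => 1 ≤ Γ'' y z)) ⊆ Z₁ ∪ Z₂ ∪ Zb := by
    intro z hz
    obtain ⟨hzZ, hz⟩ := mem_filter.1 hz
    by_contra hn
    simp only [mem_union, hZ₁, hZ₂, hZb, hZ', mem_filter, not_or, not_and, not_lt] at hn
    exact hn.2 ⟨hzZ, hn.1.1 hzZ, hn.1.2 hzZ⟩ hz
  have hcard₁ : (#Z₁ : ℝ) ≤ c ^ 2 * #Z := by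
    have h1 := h.jumbled'.swap.card_large_degree_le hp (filter_subset _ _ : Z₁ ⊆ Z)
      fun z hz => (mem_filter.1 hz).2
    have e1 : (c * (p * √p)) ^ 2 = c ^ 2 * p ^ 3 := by
      rw [mul_pow, mul_pow, Real.sq_sqrt hp.le]; ring
    rw [mul_pow, e1, Real.sq_sqrt (by positivity)] at h1
    have h2 := le_of_mul_le_mul_right (h1.trans_eq
      (by ring : _ = (p * (c ^ 2 * #Z)) * (p ^ 2 * (#X : ℝ)))) (by positivity)
    exact h2.trans (mul_le_of_le_one_left (by positivity) hp1)
  have hcard₂ : (#Z₂ : ℝ) ≤ c ^ 2 * #Z := by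
    have h1 := hJ.swap.card_large_degree_le hp (filter_subset _ _ : Z₂ ⊆ Z)
      fun z hz => (mem_filter.1 hz).2
    rw [mul_pow, Real.sq_sqrt (by positivity)] at h1
    have h2 := le_of_mul_le_mul_right (h1.trans_eq
      (by ring : _ = (p ^ 4 * (c ^ 2 * #Z)) * (p ^ 2 * (#Y : ℝ)))) (by positivity)
    exact h2.trans (mul_le_of_le_one_left (by positivity) (pow_le_one₀ hp.le hp1))
  have hbad : ∀ z ∈ Zb, ∃ A ⊆ X.filter (fun x => 1 ≤ Γ' x z),
      ∃ B ⊆ Y.filter (fun y => 1 ≤ Γ'' y z),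
      δ * p ^ 3 * #X * #Y < |∑ x ∈ A, ∑ y ∈ B, g x y| := fun z hz => by
    have := (mem_filter.1 hz).2
    simpa only [CutClose, not_forall, not_le, exists_prop] using this
  choose! A hA B hB hAB using hbad
  set S : α → ζ → ℝ := fun x z => if z ∈ Zb ∧ x ∈ A z then 1 else 0 with hS
  -- The sign, absorbed into `T`, turns the witnessed discrepancy at `z` into a signed triangle sum.
  set τ : ζ → ℝ := fun z => if 0 ≤ ∑ x ∈ A z ∩ X', ∑ y ∈ B z ∩ Y', g x y then 1 else -1 with hτ
  set T : β → ζ → ℝ := fun y z => if z ∈ Zb ∧ y ∈ B z then τ z else 0 with hT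
  have hSΓ : ∀ x ∈ X', ∀ z ∈ Z', |S x z| ≤ Γ' x z := fun x _ z _ => by
    simp only [hS]
    split_ifs with hz
    · rw [abs_one]; exact (mem_filter.1 (hA z hz.1 hz.2)).2
    · rw [abs_zero]; exact (h.unit' x z).1
  have hTΓ : ∀ y ∈ Y', ∀ z ∈ Z', |T y z| ≤ Γ'' y z := fun y _ z _ => by
    simp only [hT]
    split_ifs with hz
    · have : |τ z| = 1 := by simp only [hτ]; split_ifs <;> simp
      rw [this]; exact (mem_filter.1 (hB z hz.1 hz.2)).2
    · rw [abs_zero]; exact (h0 y z).1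
  have hcore := hdom.abs_sum_triangle_le (δ := δ ^ 4 / 128) (η := δ ^ 2 / 4) (Z := Z') hp hp1
    hc.le hc1 hb (Nat.cast_le.2 (card_le_card hZ'Z))
    (fun x _ z _ => h.unit' x z)
    (fun x hx => (sum_le_sum_of_subset_of_nonneg hZ'Z fun z _ _ => (h.unit' x z).1).trans
      (hdeg x hx))
    (fun z hz => (sum_le_sum_of_subset_of_nonneg hX' fun x _ _ => (h.unit' x z).1).trans
      (mem_filter.1 hz).2.1)
    (h.jumbled'.mono le_rfl hX' hZ'Z) (fun y _ z _ => h0 y z)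
    (fun z hz => (sum_le_sum_of_subset_of_nonneg hY' fun y _ _ => (h0 y z).1).trans
      (mem_filter.1 hz).2.2)
    (hJ.mono le_rfl hY' hZ'Z) (by positivity)
    hcod hSΓ hTΓ (by norm_num at hcδ; nlinarith [pow_pos hδ 4])
  have h4 : 24 * c ^ 2 ≤ δ / 2 := by norm_num at hcδ; nlinarith
  have hZ : ∀ z ∈ Zb, δ / 2 * p ^ 3 * #X * #Y
      ≤ ∑ y ∈ Y', T y z * ∑ x ∈ X', g x y * S x z := by
    intro z hz
    have hzZ' : z ∈ Z' := (mem_filter.1 hz).1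
    have hAX := (hA z hz).trans (filter_subset _ _)
    have hBY := (hB z hz).trans (filter_subset _ _)
    have hAc : (#(A z) : ℝ) ≤ 2 * p * #X := by
      refine le_trans ?_ (mem_filter.1 hzZ').2.1
      rw [← nsmul_one]
      exact (card_nsmul_le_sum _ _ _ fun x hx => (mem_filter.1 (hA z hz hx)).2).trans
        (sum_le_sum_of_subset_of_nonneg hAX fun x _ _ => (h.unit' x z).1)
    have hBc : (#(B z) : ℝ) ≤ 2 * p * #Y := by
      refine le_trans ?_ (mem_filter.1 hzZ').2.2
      rw [← nsmul_one]
      exact (card_nsmul_le_sum _ _ _ fun x hx => (mem_filter.1 (hB z hz hx)).2).trans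
        (sum_le_sum_of_subset_of_nonneg hBY fun x _ _ => (h0 x z).1)
    -- The witnesses have relative size at most `2 * p`, so the discarding error gains the extra
    -- factor `p` needed against `p ^ 3`.
    have h1 := h.jumbled.abs_sum_le_discard (μ := 2 * p) hp hp1 hc.le (by linarith)
      (fun x _ y _ => h.abs_le x y)
      (hXa _ sdiff_subset fun x hx => (mem_sdiff.1 hx).2)
      (hYa _ sdiff_subset fun x hx => (mem_sdiff.1 hx).2) hAX hBY hAc hBc
    have h2 : |∑ x ∈ A z ∩ X', ∑ y ∈ B z ∩ Y', g x y|
        = ∑ y ∈ Y', T y z * ∑ x ∈ X', g x y * S x z := by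
      have e1 : |∑ x ∈ A z ∩ X', ∑ y ∈ B z ∩ Y', g x y|
          = τ z * ∑ x ∈ A z ∩ X', ∑ y ∈ B z ∩ Y', g x y := by
        simp only [hτ]
        split_ifs with hs
        · rw [abs_of_nonneg hs, one_mul]
        · rw [abs_of_neg (not_le.1 hs), neg_one_mul]
      rw [e1, sum_comm, mul_sum]
      simp only [hT, hS, hz, true_and, mul_ite, mul_one, mul_zero, ite_mul, zero_mul]
      rw [← sum_filter, filter_mem_eq_inter, inter_comm]
      refine sum_congr rfl fun y _ => ?_
      rw [← sum_filter, filter_mem_eq_inter, inter_comm]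
    have h3 := hAB z hz
    have h5 : 24 * c ^ 2 * (p ^ 3 * #X * #Y) ≤ δ / 2 * (p ^ 3 * #X * #Y) := by gcongr
    linarith
  have h6 : (#Zb : ℝ) * (δ / 2 * p ^ 3 * #X * #Y) ≤ δ ^ 2 / 4 * p ^ 3 * #X * #Y * #Z := by
    refine le_trans ?_ hcore
    rw [sum_comm, ← nsmul_eq_mul]
    refine (card_nsmul_le_sum _ _ _ hZ).trans (le_of_eq ?_)
    refine sum_subset (filter_subset _ _) fun z _ hz => ?_
    simp [hT, hz]
  have h7 : (#Zb : ℝ) ≤ δ / 2 * #Z := le_of_mul_le_mul_right (h6.trans_eq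
    (by ring : _ = (δ / 2 * #Z) * (δ / 2 * p ^ 3 * #X * (#Y : ℝ)))) (by positivity)
  have h8 : (#(Z₁ ∪ Z₂ ∪ Zb) : ℝ) ≤ #Z₁ + #Z₂ + #Zb := by
    exact_mod_cast (card_union_le _ _).trans (Nat.add_le_add_right (card_union_le _ _) _)
  refine (Nat.cast_le.2 (card_le_card hcover)).trans (h8.trans ?_)
  have : 24 * c ^ 2 * #Z ≤ δ / 2 * (#Z : ℝ) := by gcongr
  nlinarith [mul_nonneg (sq_nonneg c) hd.le]

end

/-! ### Graphs as kernels -/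

open Classical in
/-- The adjacency relation of a graph as a real kernel. -/
noncomputable def adjKernel (G : SimpleGraph V) (x y : V) : ℝ := if G.Adj x y then 1 else 0

theorem adjKernel_comm (G : SimpleGraph V) (x y : V) : adjKernel G x y = adjKernel G y x := by
  by_cases h : G.Adj x y <;> simp [adjKernel, h, G.adj_comm y x]

theorem adjKernel_unit (G : SimpleGraph V) (x y : V) : 0 ≤ adjKernel G x y ∧ adjKernel G x y ≤ 1 := by
  unfold adjKernel; split_ifs <;> simp

theorem adjKernel_mono {G Γ : SimpleGraph V} (h : G ≤ Γ) (x y : V) :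
    adjKernel G x y ≤ adjKernel Γ x y := by
  unfold adjKernel
  by_cases hG : G.Adj x y
  · simp [hG, h hG]
  · simp only [hG, if_false]; split_ifs <;> simp

theorem one_le_adjKernel_iff {G : SimpleGraph V} {x y : V} : 1 ≤ adjKernel G x y ↔ G.Adj x y := by
  unfold adjKernel; split_ifs with h <;> simp [h]

theorem abs_adjKernel_sub_le {G Γ : SimpleGraph V} (h : G ≤ Γ) {p q : ℝ} (hp : 0 ≤ p)
    (hq : 0 ≤ q) (hq2 : q ≤ 2) (x y : V) :
    |adjKernel G x y - q * p| ≤ adjKernel Γ x y + 2 * p := by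
  have h1 := adjKernel_unit G x y
  have h2 := adjKernel_mono h x y
  have h3 : 0 ≤ q * p := mul_nonneg hq hp
  have h4 : q * p ≤ 2 * p := by gcongr
  rw [abs_le]
  constructor <;> linarith [h1.1]

theorem edgesBetween_eq_sum (G : SimpleGraph V) (A B : Finset V) :
    (edgesBetween G A B : ℝ) = ∑ x ∈ A, ∑ y ∈ B, adjKernel G x y := by
  classical
  unfold edgesBetween adjKernel
  rw [← sum_product', SimpleGraph.interedges, Rel.interedges, card_filter]
  push_cast
  exact sum_congr rfl fun x _ => by congr

open Classical in
theorem card_filter_adj_eq_sum (G : SimpleGraph V) (v : V) (C : Finset V) :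
    (#(C.filter (G.Adj v)) : ℝ) = ∑ x ∈ C, adjKernel G v x := by
  rw [card_filter]
  push_cast
  rfl

/-- In a cut-close pair few vertices have small degree. -/
theorem CutClose.card_small_degree_le {G : SimpleGraph V} {p q c η : ℝ} {Z X : Finset V}
    (h : CutClose (fun x y => adjKernel G x y - q * p) (c * p * #Z * #X) Z X)
    (hp : 0 < p) (hX : X.Nonempty) {B : Finset V} (hBZ : B ⊆ Z)
    (hB : ∀ z ∈ B, ∑ x ∈ X, adjKernel G z x < (1 - η) * (q * p) * #X) :
    #B * (η * q) ≤ c * #Z := by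
  have hX0 : (0 : ℝ) < #X := Nat.cast_pos.2 hX.card_pos
  have h1 := (abs_le.1 (h B hBZ X Subset.rfl)).1
  simp only [sum_sub_distrib, sum_const, nsmul_eq_mul] at h1
  have h2 : ∑ z ∈ B, ∑ x ∈ X, adjKernel G z x ≤ #B * ((1 - η) * (q * p) * #X) := by
    rw [← nsmul_eq_mul]
    exact sum_le_card_nsmul _ _ _ fun z hz => (hB z hz).le
  exact le_of_mul_le_mul_right (by linarith : #B * (η * q) * (p * #X) ≤ c * #Z * (p * (#X : ℝ)))
    (by positivity)

/-! ### Removing the first vertex of the pattern graph -/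

section Removal
variable {m : ℕ} (H : SimpleGraph (Fin (m + 1)))

open Classical in
/-- Whether the vertex `j + 1` is adjacent to the vertex `0`, as a number. -/
noncomputable def adjZero (j : Fin m) : ℕ := if H.Adj 0 j.succ then 1 else 0

open Classical in
/-- The candidates for the vertices `1, …, m` once the vertex `0` has been mapped to `v`. -/
noncomputable def candidates (G : SimpleGraph V) (C : Fin (m + 1) → Finset V) (v : V) (j : Fin m) : Finset V :=
  if H.Adj 0 j.succ then (C j.succ).filter (G.Adj v) else C j.succ

theorem candidates_subset (G : SimpleGraph V) (C : Fin (m + 1) → Finset V) (v : V) (j : Fin m) :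
    candidates H G C v j ⊆ C j.succ := by
  classical
  unfold candidates; split_ifs
  · exact filter_subset _ _
  · rfl

theorem partiteCopies_succ (G : SimpleGraph V) (C : Fin (m + 1) → Finset V) :
    partiteCopies H G C
      = ∑ v ∈ C 0, partiteCopies (H.comap Fin.succ) G (candidates H G C v) := by
  classical
  unfold partiteCopies
  rw [← card_sigma]
  refine card_bij' (fun f _ => ⟨f 0, Fin.tail f⟩) (fun q _ => Fin.cons q.1 q.2) ?_ ?_ ?_ ?_
  · intro f hf
    simp only [mem_filter, Fintype.mem_piFinset] at hf
    simp only [mem_sigma, mem_filter, Fintype.mem_piFinset]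
    refine ⟨hf.1 0, fun j => ?_, fun i j hij => hf.2 _ _ hij⟩
    unfold candidates
    split_ifs with h0
    · exact mem_filter.2 ⟨hf.1 _, hf.2 _ _ h0⟩
    · exact hf.1 _
  · rintro ⟨v, f⟩ hf
    simp only [mem_sigma, mem_filter, Fintype.mem_piFinset] at hf
    simp only [mem_filter, Fintype.mem_piFinset]
    have h0 : ∀ j : Fin m, H.Adj 0 j.succ → G.Adj v (f j) := fun j hj => by
      have := hf.2.1 j
      rw [candidates, if_pos hj] at this
      exact (mem_filter.1 this).2
    refine ⟨fun j => ?_, fun i j => ?_⟩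
    · refine Fin.cases ?_ (fun j => ?_) j
      · exact hf.1
      · exact candidates_subset H G C v j (hf.2.1 j)
    · refine Fin.cases ?_ (fun i => ?_) i
      · refine Fin.cases ?_ (fun j => ?_) j
        · exact fun h => (H.loopless.irrefl _ h).elim
        · exact fun h => h0 j h
      · refine Fin.cases ?_ (fun j => ?_) j
        · exact fun h => (h0 i h.symm).symm
        · exact fun h => hf.2.2 i j h
  · intro f _
    exact Fin.cons_self_tail f
  · rintro ⟨v, f⟩ _
    simp [Fin.tail_cons]

theorem prod_orderedEdges_eq {n : ℕ} (H : SimpleGraph (Fin n)) (f : Fin n → Fin n → ℝ) :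
    ∏ e ∈ orderedEdges H, f e.1 e.2
      = ∏ i, ∏ j, open Classical in if i < j ∧ H.Adj i j then f i j else 1 := by
  classical
  rw [orderedEdges, prod_filter, ← univ_product_univ, prod_product]

open Classical in
theorem prod_orderedEdges_succ (f : Fin (m + 1) → Fin (m + 1) → ℝ) :
    ∏ e ∈ orderedEdges H, f e.1 e.2
      = (∏ j : Fin m, if H.Adj 0 j.succ then f 0 j.succ else 1)
        * ∏ e ∈ orderedEdges (H.comap Fin.succ), f e.1.succ e.2.succ := by
  rw [prod_orderedEdges_eq, prod_orderedEdges_eq (H.comap Fin.succ) fun i j => f i.succ j.succ,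
    Fin.prod_univ_succ]
  congr 1
  · rw [Fin.prod_univ_succ]
    simp [Fin.succ_pos]
  · refine prod_congr rfl fun i _ => ?_
    rw [Fin.prod_univ_succ]
    simp [Fin.succ_lt_succ_iff]

theorem numBefore_zero (j : Fin (m + 1)) : numBefore H 0 j = 0 := by
  simp [numBefore]

/-- The vertex 0 precedes every `i.succ`, so it counts exactly when adjacent to `j.succ`. -/
theorem numBefore_succ (i j : Fin m) :
    numBefore H i.succ j.succ = adjZero H j + numBefore (H.comap Fin.succ) i j := by
  classical
  unfold numBefore adjZero
  rw [card_filter, card_filter, Fin.sum_univ_succ]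
  congr 1
  · simp [Fin.succ_pos, H.adj_comm]
  · simp [Fin.succ_lt_succ_iff]

end Removal

/-! ### Exponents and the state of the embedding -/

/-- The lower bounds on the exponent `k` which are used when `a j` neighbours of each vertex `j`
have been embedded already. -/
structure ExponentBound {m : ℕ} (H : SimpleGraph (Fin m)) (a : Fin m → ℕ) (k : ℝ) : Prop where
  path : ∀ i j l, i < j → i < l → H.Adj i j → H.Adj j l →
    ((a i + numBefore H i i : ℕ) : ℝ) / 2 + ((a j + numBefore H i j : ℕ) : ℝ) / 2 + 3 / 2 ≤ k
  triangle : ∀ i j l, i < j → i < l → H.Adj i j → H.Adj i l → H.Adj j l →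
    a l + numBefore H i l ≤ a j + numBefore H i j →
    ((a i + numBefore H i i : ℕ) : ℝ) / 2 + ((a j + numBefore H i j : ℕ) : ℝ) / 2 + 3 ≤ k
  far : ∀ i j l, i < j → i < l → H.Adj i j → H.Adj j l →
    ((a j + numBefore H i j : ℕ) : ℝ) / 2 + ((a l + numBefore H i l : ℕ) : ℝ) / 2 + 2 ≤ k

/-- The bounds depend only on sums `a j + numBefore H i j`, and embedding vertex 0 moves its
contribution from the second summand to the first. Hence one `k` serves the whole induction. -/
theorem ExponentBound.succ {m : ℕ} {H : SimpleGraph (Fin (m + 1))} {a : Fin (m + 1) → ℕ} {k : ℝ}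
    (h : ExponentBound H a k) :
    ExponentBound (H.comap Fin.succ) (fun j => a j.succ + adjZero H j) k := by
  have e : ∀ i j : Fin m, a j.succ + adjZero H j + numBefore (H.comap Fin.succ) i j
      = a j.succ + numBefore H i.succ j.succ := fun i j => by rw [numBefore_succ, add_assoc]
  constructor
  · intro i j l hij hil h1 h2
    rw [e, e]
    exact h.path _ _ _ (Fin.succ_lt_succ_iff.2 hij) (Fin.succ_lt_succ_iff.2 hil) h1 h2
  · intro i j l hij hil h1 h2 h3 h4
    rw [e, e] at h4 ⊢
    exact h.triangle _ _ _ (Fin.succ_lt_succ_iff.2 hij) (Fin.succ_lt_succ_iff.2 hil) h1 h2 h3 h4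
  · intro i j l hij hil h1 h2
    rw [e, e]
    exact h.far _ _ _ (Fin.succ_lt_succ_iff.2 hij) (Fin.succ_lt_succ_iff.2 hil) h1 h2

/-- The vertex `l` forces `caseTerm` to be at least 3/2, and equal to 3 in the triangle case. For
`far` the constant 2 suffices, which both 2.001 and 2.501 exceed. -/
theorem IsKRegBound.exponentBound {m : ℕ} {H : SimpleGraph (Fin m)} {k : ℝ}
    (h : IsKRegBound H k) : ExponentBound H (fun _ => 0) k := by
  constructor
  · intro i j l hij hil h1 h2
    have h3 := h.1 i j hij h1
    have : 3 / 2 ≤ caseTerm H i j := by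
      unfold caseTerm
      split_ifs with c1 c2 c3
      · norm_num
      · norm_num
      · norm_num
      · exact (c3 ⟨l, hil, h2⟩).elim
    simp only [zero_add]
    linarith
  · intro i j l hij hil h1 h2 h3 h4
    have h5 := h.1 i j hij h1
    have : 3 ≤ caseTerm H i j := by
      unfold caseTerm
      rw [if_pos ⟨l, hil, h3, h2, by simpa using h4⟩]
    simp only [zero_add]
    linarith
  · intro i j l hij hil h1 h2
    have h3 := h.2 i j l hij hil h1 h2
    simp only [zero_add]
    split_ifs at h3 <;> norm_num at h3 <;> linarith

/-- The state of the embedding: candidate sets `C i` for the vertices of `H` such that the pairs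
along edges are cut-close in `G` and jumbled in `Γ`. -/
structure EmbeddingState {m : ℕ} (H : SimpleGraph (Fin m)) (a : Fin m → ℕ) (k c α p : ℝ)
    (G Γ : SimpleGraph V) (C : Fin m → Finset V) (q : Fin m → Fin m → ℝ) : Prop where
  density : ∀ i j, H.Adj i j → α ≤ q i j ∧ q i j ≤ 2
  cut : ∀ i j, H.Adj i j →
    CutClose (fun x y => adjKernel G x y - q i j * p) (c * p * #(C i) * #(C j)) (C i) (C j)
  jumbled : ∀ i j, H.Adj i j →
    Jumbled (adjKernel Γ) p (c * p ^ (k - a i / 2 - a j / 2) * √((#(C i) : ℝ) * #(C j)))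
      (C i) (C j)

theorem mul_sqrt_eq_rpow {p : ℝ} (hp : 0 < p) : p * √p = p ^ (3 / 2 : ℝ) := by
  rw [Real.sqrt_eq_rpow, ← Real.rpow_one_add' hp.le (by norm_num)]
  norm_num

section
variable {m : ℕ} {H : SimpleGraph (Fin (m + 1))} {a : Fin (m + 1) → ℕ} {k c α p : ℝ}
  {G Γ : SimpleGraph V} {C : Fin (m + 1) → Finset V} {q : Fin (m + 1) → Fin (m + 1) → ℝ}

theorem EmbeddingState.jumbled_of_le (hS : EmbeddingState H a k c α p G Γ C q) (hp : 0 < p)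
    (hp1 : p ≤ 1) (hc : 0 < c) {i j : Fin (m + 1)} (hij : H.Adj i j) {e : ℝ}
    (he : e ≤ k - a i / 2 - a j / 2) :
    Jumbled (adjKernel Γ) p (c * p ^ e * √((#(C i) : ℝ) * #(C j))) (C i) (C j) := by
  refine (hS.jumbled i j hij).mono ?_ Subset.rfl Subset.rfl
  gcongr ?_ * ?_ * ?_
  exact Real.rpow_le_rpow_of_exponent_ge hp hp1 he

/-- The apex is the vertex 0, before which nothing is left to embed. So `far` yields exponent 2 on
the pair opposite the apex, and `path` yields exponent 3/2 towards the apex. -/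
theorem EmbeddingState.inheritancePair (hS : EmbeddingState H a k c α p G Γ C q)
    (hE : ExponentBound H a k) (hp : 0 < p) (hp1 : p ≤ 1) (hc : 0 < c)
    (hne : ∀ i, (C i).Nonempty) {x y : Fin m} (h0 : H.Adj 0 x.succ) (hxy : H.Adj x.succ y.succ)
    {g : V → V → ℝ} (hg : ∀ v w, |g v w| ≤ adjKernel Γ v w + 2 * p)
    (hcut : CutClose g (c * p * #(C x.succ) * #(C y.succ)) (C x.succ) (C y.succ)) :
    InheritancePair g (adjKernel Γ) (adjKernel Γ) p c (C x.succ) (C y.succ) (C 0) where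
  unit := adjKernel_unit Γ
  unit' := adjKernel_unit Γ
  abs_le := hg
  jumbled := by
    have := hE.far 0 x.succ y.succ (Fin.succ_pos _) (Fin.succ_pos _) h0 hxy
    simp only [numBefore_zero, add_zero] at this
    rw [← Real.rpow_two]
    exact hS.jumbled_of_le hp hp1 hc hxy (by linarith)
  jumbled' := by
    have := hE.path 0 x.succ y.succ (Fin.succ_pos _) (Fin.succ_pos _) h0 hxy
    simp only [numBefore_zero, add_zero] at this
    rw [mul_sqrt_eq_rpow hp]
    exact hS.jumbled_of_le hp hp1 hc h0.symm (by linarith)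
  cut := hcut
  right_nonempty := hne _
  apex_nonempty := hne _

theorem candidates_subset_filter (hG : G ≤ Γ) {i : Fin m} (h0 : H.Adj 0 i.succ) (v : V) :
    candidates H G C v i ⊆
      open Classical in (C i.succ).filter fun x => 1 ≤ adjKernel Γ x v := by
  classical
  intro x hx
  rw [candidates, if_pos h0] at hx
  obtain ⟨h1, h2⟩ := mem_filter.1 hx
  exact mem_filter.2 ⟨h1, one_le_adjKernel_iff.2 (hG h2).symm⟩

open Classical in
/-- For most images `v` of the vertex `0`, a given pair of candidate sets remains cut-close. -/
theorem EmbeddingState.card_not_cutClose_le (hS : EmbeddingState H a k c α p G Γ C q)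
    (hE : ExponentBound H a k) (hG : G ≤ Γ) (hα : 0 < α) (hp : 0 < p) (hp1 : p ≤ 1) (hc : 0 < c)
    (hne : ∀ i, (C i).Nonempty) {δ : ℝ} (hδ : 0 < δ) (hδ1 : δ ≤ 1) (hcδ : c ≤ δ ^ 8 / 2 ^ 23)
    {i j : Fin m} (hij : H.Adj i.succ j.succ) :
    (#((C 0).filter fun v => ¬ CutClose (fun x y => adjKernel G x y - q i.succ j.succ * p)
      (δ * p ^ (1 + adjZero H i + adjZero H j) * #(C i.succ) * #(C j.succ))
      (candidates H G C v i) (candidates H G C v j)) : ℝ) ≤ δ * #(C 0) := by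
  set g : V → V → ℝ := fun x y => adjKernel G x y - q i.succ j.succ * p with hg
  have hcut := hS.cut _ _ hij
  obtain ⟨hq0, hq2⟩ := hS.density _ _ hij
  have hgle : ∀ v w, |g v w| ≤ adjKernel Γ v w + 2 * p :=
    abs_adjKernel_sub_le hG hp.le (hα.le.trans hq0) hq2
  have hgle' : ∀ v w, |g w v| ≤ adjKernel Γ v w + 2 * p := fun v w => by
    rw [adjKernel_comm]; exact hgle w v
  have hcut' : CutClose (fun x y => g y x) (c * p * #(C j.succ) * #(C i.succ))
      (C j.succ) (C i.succ) := hcut.swap.mono (le_of_eq (by ring)) Subset.rfl Subset.rfl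
  have key : ∀ P : V → Prop, ((#((C 0).filter fun v => ¬ P v) : ℝ) ≤ δ * #(C 0)) →
      (∀ v, P v → CutClose g (δ * p ^ (1 + adjZero H i + adjZero H j) * #(C i.succ) * #(C j.succ))
      (candidates H G C v i) (candidates H G C v j)) →
      (#((C 0).filter fun v => ¬ CutClose g
      (δ * p ^ (1 + adjZero H i + adjZero H j) * #(C i.succ) * #(C j.succ))
      (candidates H G C v i) (candidates H G C v j)) : ℝ) ≤ δ * #(C 0) := fun P h1 h2 => by
    refine le_trans (Nat.cast_le.2 (card_le_card fun v hv => ?_)) h1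
    obtain ⟨h3, h4⟩ := mem_filter.1 hv
    exact mem_filter.2 ⟨h3, fun h5 => h4 (h2 v h5)⟩
  have hci := candidates_subset H G C
  have three : ∀ x y : Fin m, H.Adj 0 x.succ → H.Adj 0 y.succ → H.Adj x.succ y.succ →
      a y.succ ≤ a x.succ →
      Jumbled (adjKernel Γ) p (c * p ^ 3 * √((#(C x.succ) : ℝ) * #(C 0))) (C x.succ) (C 0) := by
    intro x y hx hy hxy hle
    have := hE.triangle 0 x.succ y.succ (Fin.succ_pos _) (Fin.succ_pos _) hx hy hxy
      (by simpa only [numBefore_zero, add_zero] using hle)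
    simp only [numBefore_zero, add_zero] at this
    have h3 := hS.jumbled_of_le hp hp1 hc hx.symm (e := (3 : ℕ)) (by push_cast; linarith)
    rwa [Real.rpow_natCast] at h3
  by_cases hi : H.Adj 0 i.succ <;> by_cases hj : H.Adj 0 j.succ
  · have hpow : 1 + adjZero H i + adjZero H j = 3 := by simp [adjZero, hi, hj]
    rw [hpow] at key ⊢
    -- The endpoint with more embedded neighbours takes the role of `Y`, for which `triangle`
    -- supplies exponent 3 towards `C 0`.
    rcases le_total (a i.succ) (a j.succ) with hle | hle
    · refine key _ ((hS.inheritancePair hE hp hp1 hc hne hi hij hgle hcut).two_sided hp hp1 hc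
        hδ hδ1 hcδ (adjKernel_unit Γ) (three j i hj hi hij.symm hle)) fun v hv => ?_
      exact hv.mono le_rfl (candidates_subset_filter hG hi v) (candidates_subset_filter hG hj v)
    · refine key _ ((hS.inheritancePair hE hp hp1 hc hne hj hij.symm hgle' hcut').two_sided
        hp hp1 hc hδ hδ1 hcδ (adjKernel_unit Γ) (three i j hi hj hij hle)) fun v hv => ?_
      exact hv.swap.mono (le_of_eq (by ring)) (candidates_subset_filter hG hi v)
        (candidates_subset_filter hG hj v)
  · have hpow : 1 + adjZero H i + adjZero H j = 2 := by simp [adjZero, hi, hj]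
    rw [hpow] at key ⊢
    refine key _ ((hS.inheritancePair hE hp hp1 hc hne hi hij hgle hcut).one_sided hp hp1 hc
        hδ hδ1 hcδ) fun v hv => ?_
    exact hv.mono le_rfl (candidates_subset_filter hG hi v) (hci v j)
  · have hpow : 1 + adjZero H i + adjZero H j = 2 := by simp [adjZero, hi, hj]
    rw [hpow] at key ⊢
    refine key _ ((hS.inheritancePair hE hp hp1 hc hne hj hij.symm hgle' hcut').one_sided
        hp hp1 hc hδ hδ1 hcδ) fun v hv => ?_
    exact hv.swap.mono (le_of_eq (by ring)) (hci v i) (candidates_subset_filter hG hj v)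
  · have hpow : 1 + adjZero H i + adjZero H j = 1 := by simp [adjZero, hi, hj]
    rw [hpow] at key ⊢
    -- Neither candidate set changes, so every `v` is admissible.
    refine key (fun _ => True) (by simp; positivity) fun v _ => ?_
    refine hcut.mono ?_ (hci v i) (hci v j)
    have hδ8 : δ ^ 8 ≤ δ := by
      have : δ ^ 7 ≤ 1 := pow_le_one₀ hδ.le hδ1
      nlinarith
    have : c ≤ δ := by norm_num at hcδ; linarith
    rw [pow_one]
    gcongr

/-- The state after the vertex `0` has been mapped to a suitable vertex `v`. -/
theorem EmbeddingState.succ (hS : EmbeddingState H a k c α p G Γ C q) (hp : 0 < p)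
    {c' β δ : ℝ} (hc' : 0 < c') (hβ : 0 < β) (hcc' : c ≤ c' * β)
    (hδ : δ ≤ c' * β ^ 2) {v : V}
    (hcard : ∀ j, β * p ^ adjZero H j * #(C j.succ) ≤ #(candidates H G C v j))
    (hcut : ∀ i j : Fin m, H.Adj i.succ j.succ →
      CutClose (fun x y => adjKernel G x y - q i.succ j.succ * p)
      (δ * p ^ (1 + adjZero H i + adjZero H j) * #(C i.succ) * #(C j.succ))
      (candidates H G C v i) (candidates H G C v j)) :
    EmbeddingState (H.comap Fin.succ) (fun j => a j.succ + adjZero H j) k c' α p G Γ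
      (candidates H G C v) (fun i j => q i.succ j.succ) where
  density i j hij := hS.density _ _ hij
  cut i j hij := by
    refine (hcut i j hij).mono ?_ Subset.rfl Subset.rfl
    calc δ * p ^ (1 + adjZero H i + adjZero H j) * #(C i.succ) * #(C j.succ)
        ≤ c' * β ^ 2 * p ^ (1 + adjZero H i + adjZero H j) * #(C i.succ) * #(C j.succ) := by
          gcongr
      _ = c' * p * (β * p ^ adjZero H i * #(C i.succ)) * (β * p ^ adjZero H j * #(C j.succ)) := by
          rw [pow_add, pow_add]; ring
      _ ≤ _ := by
          have := hcard i
          have := hcard j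
          gcongr
  jumbled i j hij := by
    refine (hS.jumbled _ _ hij).mono ?_ (candidates_subset H G C v i) (candidates_subset H G C v j)
    set s := adjZero H i + adjZero H j with hs
    -- The exponent drops by one half for each of the two candidate sets that shrinks by a factor of
    -- order `p`. This matches the decrease of the square root of the product of their sizes.
    have e1 : k - (a i.succ : ℝ) / 2 - a j.succ / 2
        = (k - ((a i.succ + adjZero H i : ℕ) : ℝ) / 2 - ((a j.succ + adjZero H j : ℕ) : ℝ) / 2)
          + (s : ℝ) / 2 := by
      rw [hs]; push_cast; ring
    have e2 : p ^ ((s : ℝ) / 2) = √(p ^ s) := by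
      rw [Real.sqrt_eq_rpow, ← Real.rpow_natCast, ← Real.rpow_mul hp.le]
      congr 1; ring
    rw [e1, Real.rpow_add hp, e2]
    set P := p ^ (k - ((a i.succ + adjZero H i : ℕ) : ℝ) / 2
      - ((a j.succ + adjZero H j : ℕ) : ℝ) / 2)
    have hP : 0 < P := Real.rpow_pos_of_pos hp _
    have h1 : β * (√(p ^ s) * √((#(C i.succ) : ℝ) * #(C j.succ)))
        ≤ √((#(candidates H G C v i) : ℝ) * #(candidates H G C v j)) := by
      rw [← Real.sqrt_mul (by positivity), ← Real.sqrt_sq hβ.le, ← Real.sqrt_mul (by positivity)]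
      apply Real.sqrt_le_sqrt
      calc β ^ 2 * (p ^ s * (#(C i.succ) * #(C j.succ)))
          = (β * p ^ adjZero H i * #(C i.succ)) * (β * p ^ adjZero H j * #(C j.succ)) := by
            rw [hs, pow_add]; ring
        _ ≤ _ := mul_le_mul (hcard i) (hcard j) (by positivity) (by positivity)
    calc c * (P * √(p ^ s)) * √((#(C i.succ) : ℝ) * #(C j.succ))
        ≤ c' * β * (P * √(p ^ s)) * √((#(C i.succ) : ℝ) * #(C j.succ)) := by gcongr
      _ = c' * P * (β * (√(p ^ s) * √((#(C i.succ) : ℝ) * #(C j.succ)))) := by ring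
      _ ≤ _ := by gcongr

end

/-! ### Images of the first vertex that keep the state intact -/

section
variable {m : ℕ} {H : SimpleGraph (Fin (m + 1))} {a : Fin (m + 1) → ℕ} {k c α p : ℝ}
  {G Γ : SimpleGraph V} {C : Fin (m + 1) → Finset V} {q : Fin (m + 1) → Fin (m + 1) → ℝ}

/-- The images `v` of the vertex `0` which leave enough candidates and keep all pairs of candidate
sets cut-close. -/
structure GoodImage (H : SimpleGraph (Fin (m + 1))) (G : SimpleGraph V)
    (C : Fin (m + 1) → Finset V) (q : Fin (m + 1) → Fin (m + 1) → ℝ) (p δ η : ℝ) (v : V) :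
    Prop where
  degree : ∀ j : Fin m, H.Adj 0 j.succ →
    (1 - η) * (q 0 j.succ * p) * #(C j.succ) ≤ ∑ x ∈ C j.succ, adjKernel G v x
  cut : ∀ i j : Fin m, H.Adj i.succ j.succ →
    CutClose (fun x y => adjKernel G x y - q i.succ j.succ * p)
      (δ * p ^ (1 + adjZero H i + adjZero H j) * #(C i.succ) * #(C j.succ))
      (candidates H G C v i) (candidates H G C v j)

-- Union bound: at most `m` degree conditions and `m ^ 2` cut conditions, each failing for at most
-- `δ * #(C 0)` vertices.
open Classical in
theorem EmbeddingState.card_bad_le (hS : EmbeddingState H a k c α p G Γ C q)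
    (hE : ExponentBound H a k) (hG : G ≤ Γ) (hα : 0 < α) (hp : 0 < p) (hp1 : p ≤ 1) (hc : 0 < c)
    (hne : ∀ i, (C i).Nonempty) {δ η : ℝ} (hδ : 0 < δ) (hδ1 : δ ≤ 1) (hcδ : c ≤ δ ^ 8 / 2 ^ 23)
    (hη : 0 < η) (hcη : c ≤ η * α * δ) :
    (#((C 0).filter fun v => ¬ GoodImage H G C q p δ η v) : ℝ)
      ≤ ((m : ℝ) + m ^ 2) * δ * #(C 0) := by
  set D : Fin m → Finset V := fun j => (C 0).filter fun v => ¬ (H.Adj 0 j.succ →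
    (1 - η) * (q 0 j.succ * p) * #(C j.succ) ≤ ∑ x ∈ C j.succ, adjKernel G v x) with hD
  set B : Fin m → Fin m → Finset V := fun i j => (C 0).filter fun v => ¬ (H.Adj i.succ j.succ →
    CutClose (fun x y => adjKernel G x y - q i.succ j.succ * p)
      (δ * p ^ (1 + adjZero H i + adjZero H j) * #(C i.succ) * #(C j.succ))
      (candidates H G C v i) (candidates H G C v j)) with hB
  have hDc : ∀ j, (#(D j) : ℝ) ≤ δ * #(C 0) := fun j => by
    by_cases h0 : H.Adj 0 j.succ
    · have hq := (hS.density _ _ h0).1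
      have h1 := (hS.cut _ _ h0).card_small_degree_le hp (hne _) (η := η)
        (filter_subset _ _ : D j ⊆ C 0) fun z hz => by
          have := (mem_filter.1 hz).2
          simpa only [h0, true_imp_iff, not_le] using this
      refine le_of_mul_le_mul_right (a := η * α) ?_ (by positivity)
      calc (#(D j) : ℝ) * (η * α) ≤ #(D j) * (η * q 0 j.succ) := by gcongr
        _ ≤ c * #(C 0) := h1
        _ ≤ η * α * δ * #(C 0) := by gcongr
        _ = _ := by ring
    · have : D j = ∅ := by simp [hD, h0]
      rw [this]; simp; positivity
  have hBc : ∀ i j, (#(B i j) : ℝ) ≤ δ * #(C 0) := fun i j => by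
    by_cases h0 : H.Adj i.succ j.succ
    · simp only [hB, h0, true_imp_iff]
      exact hS.card_not_cutClose_le hE hG hα hp hp1 hc hne hδ hδ1 hcδ h0
    · have : B i j = ∅ := by simp [hB, h0]
      rw [this]; simp; positivity
  have hsub : ((C 0).filter fun v => ¬ GoodImage H G C q p δ η v)
      ⊆ (univ.biUnion D) ∪ univ.biUnion fun i => univ.biUnion (B i) := fun v hv => by
    obtain ⟨h1, h2⟩ := mem_filter.1 hv
    by_contra hn
    simp only [mem_union, mem_biUnion, mem_univ, true_and, not_or, not_exists, hD, hB,
      mem_filter, h1, not_not] at hn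
    exact h2 ⟨hn.1, hn.2⟩
  have hnat := (card_le_card hsub).trans ((card_union_le _ _).trans (Nat.add_le_add card_biUnion_le
    (card_biUnion_le.trans (sum_le_sum fun i _ => card_biUnion_le))))
  refine (Nat.cast_le.2 hnat).trans ?_
  push_cast
  refine (add_le_add (sum_le_sum fun j _ => hDc j)
    (sum_le_sum fun i _ => sum_le_sum fun j _ => hBc i j)).trans (le_of_eq ?_)
  simp only [sum_const, card_univ, Fintype.card_fin, nsmul_eq_mul]
  ring

theorem GoodImage.le_card_candidates {δ η : ℝ} {v : V} (hv : GoodImage H G C q p δ η v)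
    (hη : 0 ≤ η) (j : Fin m) :
    (1 - η) * (open Classical in if H.Adj 0 j.succ then q 0 j.succ * p else 1) * #(C j.succ)
      ≤ #(candidates H G C v j) := by
  classical
  unfold candidates
  split_ifs with h0
  · rw [card_filter_adj_eq_sum]
    exact hv.degree j h0
  · rw [mul_one]
    exact mul_le_of_le_one_left (Nat.cast_nonneg _) (by linarith)

open Classical in
theorem GoodImage.le_prod_card_candidates {δ η : ℝ} {v : V} (hv : GoodImage H G C q p δ η v)
    (hη : 0 ≤ η) (hη1 : η ≤ 1) (hp : 0 < p) (hq : ∀ j : Fin m, H.Adj 0 j.succ → 0 < q 0 j.succ) :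
    (1 - m * η) * (∏ j : Fin m, if H.Adj 0 j.succ then q 0 j.succ * p else 1)
      * ∏ j : Fin m, (#(C j.succ) : ℝ) ≤ ∏ j, (#(candidates H G C v j) : ℝ) := by
  have hpos : ∀ j : Fin m, 0 ≤ if H.Adj 0 j.succ then q 0 j.succ * p else 1 := fun j => by
    split_ifs with h0
    · exact (mul_pos (hq j h0) hp).le
    · exact zero_le_one
  have h1 := prod_le_prod (s := univ) (fun j _ => mul_nonneg (mul_nonneg
    (by linarith : 0 ≤ 1 - η) (hpos j)) (Nat.cast_nonneg _)) fun j _ => hv.le_card_candidates hη j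
  rw [prod_mul_distrib, prod_mul_distrib, prod_const, card_univ, Fintype.card_fin] at h1
  refine le_trans ?_ h1
  -- Bernoulli's inequality.
  have h2 : 1 - m * η ≤ (1 - η) ^ m := by
    have := one_add_mul_le_pow (a := -η) (by linarith) m
    rw [← sub_eq_add_neg] at this
    linarith
  have h3 : 0 ≤ ∏ j : Fin m, if H.Adj 0 j.succ then q 0 j.succ * p else 1 :=
    prod_nonneg fun j _ => hpos j
  gcongr

end

/-! ### Counting by induction on the number of vertices -/

set_option maxHeartbeats 1000000 in
/-- The counting lemma for an embedding state. -/
theorem EmbeddingState.exists_le_partiteCopies (m : ℕ) : ∀ (H : SimpleGraph (Fin m))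
    (a : Fin m → ℕ) (k : ℝ), ExponentBound H a k → ∀ γ : ℝ, 0 < γ → γ ≤ 1 → ∀ α : ℝ, 0 < α → α ≤ 1 →
    ∃ c : ℝ, 0 < c ∧ ∀ p : ℝ, 0 < p → p ≤ 1 → ∀ (V : Type u) (G Γ : SimpleGraph V), G ≤ Γ →
      ∀ (C : Fin m → Finset V) (q : Fin m → Fin m → ℝ), EmbeddingState H a k c α p G Γ C q →
      (1 - γ) * (∏ e ∈ orderedEdges H, (q e.1 e.2 * p)) * ∏ i, (#(C i) : ℝ)
        ≤ partiteCopies H G C := by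
  classical
  induction m with
  | zero =>
    intro H a k _ γ hγ hγ1 α _ _
    refine ⟨1, one_pos, fun p _ _ V G Γ _ C q _ => ?_⟩
    have : partiteCopies H G C = 1 := by
      unfold partiteCopies
      rw [filter_true_of_mem fun f _ i => i.elim0, Fintype.card_piFinset]
      simp
    rw [this, prod_orderedEdges_eq H fun i j => q i j * p]
    simp; linarith
  | succ m ih =>
    intro H a k hE γ hγ hγ1 α hα hα1
    obtain ⟨c₀, hc₀, hcount⟩ := ih (H.comap Fin.succ) _ k hE.succ (γ / 2) (by positivity)
      (by linarith) α hα hα1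
    set c' := min c₀ 1 with hc'
    have hc'0 : 0 < c' := lt_min hc₀ one_pos
    -- For a good image a neighbour of 0 keeps a fraction at least `(1 - η) * α * p ≥ β * p` of its
    -- candidates, since `η ≤ 1 / 4`.
    set β := α / 2 with hβ
    have hβ0 : 0 < β := by positivity
    have hm : (0 : ℝ) < (m : ℝ) + 1 := by positivity
    -- The choice gives `m * η ≤ γ / 4`, the total relative loss in candidate set sizes.
    set η := γ / (4 * ((m : ℝ) + 1)) with hη
    have hη0 : 0 < η := by positivity
    have hηm : η * (4 * (m + 1)) = γ := by rw [hη]; field_simp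
    have hη4 : η ≤ 1 / 4 := by nlinarith [(Nat.cast_nonneg m : (0 : ℝ) ≤ m)]
    -- The choice gives `(m + m ^ 2) * θ ≤ γ / 4`, the fraction of bad images.
    set θ := γ / (4 * ((m : ℝ) + 1) ^ 2) with hθ
    have hθ0 : 0 < θ := by positivity
    have hθm : θ * (4 * (m + 1) ^ 2) = γ := by rw [hθ]; field_simp
    have hθ1 : θ ≤ 1 := by nlinarith [(Nat.cast_nonneg m : (0 : ℝ) ≤ m)]
    have hb2 : 0 < c' * β ^ 2 := by positivity
    set δ := min (c' * β ^ 2) θ with hδ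
    have hδ0 : 0 < δ := lt_min hb2 hθ0
    have hδ1 : δ ≤ 1 := (min_le_right _ _).trans hθ1
    -- The first bound serves inheritance, the second the count of vertices of small degree.
    set c := min (δ ^ 8 / 2 ^ 23) (η * α * δ) with hc
    have hc0 : 0 < c := lt_min (by positivity) (by positivity)
    refine ⟨c, hc0, fun p hp hp1 V G Γ hG C q hS => ?_⟩
    by_cases hne : ∀ i, (C i).Nonempty
    swap
    · obtain ⟨i, hi⟩ := not_forall.1 hne
      have : ∏ i, (#(C i) : ℝ) = 0 := prod_eq_zero (mem_univ i) (by
        rw [not_nonempty_iff_eq_empty.1 hi]; simp)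
      rw [this, mul_zero]
      positivity
    have hbad := hS.card_bad_le hE hG hα hp hp1 hc0 hne hδ0 hδ1 (min_le_left _ _) hη0
      (min_le_right _ _)
    have hcc' : c ≤ c' * β := by
      have h1 : c ≤ η * α * δ := min_le_right _ _
      have h2 : δ ≤ c' * β ^ 2 := min_le_left _ _
      have h3 : η * α ≤ 1 := by nlinarith
      have h4 : β ≤ 1 := by linarith
      calc c ≤ η * α * δ := h1
        _ ≤ 1 * (c' * β ^ 2) := by gcongr
        _ = c' * β * β := by ring
        _ ≤ c' * β := mul_le_of_le_one_right (by positivity) h4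
    have hq0 : ∀ i j, H.Adj i j → 0 < q i j := fun i j h => hα.trans_le (hS.density i j h).1
    set P := ∏ e ∈ orderedEdges (H.comap Fin.succ), (q e.1.succ e.2.succ * p) with hP
    have hP0 : 0 ≤ P := prod_nonneg fun e he => by
      have : H.Adj e.1.succ e.2.succ := (mem_filter.1 he).2.2
      exact (mul_pos (hq0 _ _ this) hp).le
    set D := ∏ j : Fin m, if H.Adj 0 j.succ then q 0 j.succ * p else 1 with hD
    have hD0 : 0 ≤ D := prod_nonneg fun j _ => by
      split_ifs with h0
      · exact (mul_pos (hq0 _ _ h0) hp).le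
      · exact zero_le_one
    set R := ∏ j : Fin m, (#(C j.succ) : ℝ) with hR
    have hR0 : 0 ≤ R := prod_nonneg fun j _ => Nat.cast_nonneg _
    have hgood : ∀ v, GoodImage H G C q p δ η v →
        (1 - γ / 2) * P * ((1 - γ / 4) * D * R)
          ≤ partiteCopies (H.comap Fin.succ) G (candidates H G C v) := fun v hv => by
      have hstate := hS.succ hp hc'0 hβ0 hcc' (min_le_left _ _) (v := v) (fun j => by
        refine le_trans (mul_le_mul_of_nonneg_right ?_ (Nat.cast_nonneg _))
          (hv.le_card_candidates hη0.le j)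
        unfold adjZero
        split_ifs with h0
        · have := (hS.density _ _ h0).1
          rw [pow_one, ← mul_assoc]
          gcongr
          nlinarith
        · rw [pow_zero]; linarith) hv.cut
      have hstate' : EmbeddingState (H.comap Fin.succ) (fun j => a j.succ + adjZero H j) k c₀ α p
          G Γ (candidates H G C v) (fun i j => q i.succ j.succ) :=
        { density := hstate.density
          cut := fun i j hij => (hstate.cut i j hij).mono (by gcongr; exact min_le_left _ _)
            Subset.rfl Subset.rfl
          jumbled := fun i j hij => (hstate.jumbled i j hij).mono
            (by gcongr; exact min_le_left _ _) Subset.rfl Subset.rfl }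
      refine le_trans ?_ (hcount p hp hp1 V G Γ hG _ _ hstate')
      have h1 := hv.le_prod_card_candidates hη0.le (by linarith) hp fun j h0 => hq0 _ _ h0
      have h2 : (1 - γ / 4) * D * R ≤ ∏ j, (#(candidates H G C v j) : ℝ) := by
        refine le_trans ?_ h1
        gcongr
        nlinarith
      exact mul_le_mul_of_nonneg_left h2 (mul_nonneg (by linarith) hP0)
    have hcardgood : (1 - γ / 4) * #(C 0) ≤ #((C 0).filter fun v => GoodImage H G C q p δ η v) := by
      have h1 : (#((C 0).filter fun v => GoodImage H G C q p δ η v) : ℝ)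
          + #((C 0).filter fun v => ¬ GoodImage H G C q p δ η v) = #(C 0) := by
        exact_mod_cast card_filter_add_card_filter_not _
      have h2 : ((m : ℝ) + m ^ 2) * δ ≤ γ / 4 := by
        have h3 : δ ≤ θ := min_le_right _ _
        have h4 : (0 : ℝ) ≤ m := Nat.cast_nonneg m
        calc ((m : ℝ) + m ^ 2) * δ ≤ (m + 1) ^ 2 * θ := by gcongr; nlinarith
          _ = γ / 4 := by linarith
      have h3 := mul_le_mul_of_nonneg_right h2 (Nat.cast_nonneg (α := ℝ) #(C 0))
      linarith
    have hE0 : 0 ≤ (1 - γ / 2) * P * ((1 - γ / 4) * D * R) :=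
      mul_nonneg (mul_nonneg (by linarith) hP0) (mul_nonneg (mul_nonneg (by linarith) hD0) hR0)
    rw [partiteCopies_succ, prod_orderedEdges_succ H fun i j => q i j * p, Fin.prod_univ_succ]
    push_cast
    calc (1 - γ) * (D * P) * (#(C 0) * R)
        = (1 - γ) * (D * P * R * #(C 0)) := by ring
      -- The three factors are the fraction of good images, the induction hypothesis with `γ / 2`,
      -- and the loss in candidate set sizes.
      _ ≤ ((1 - γ / 4) * (1 - γ / 2) * (1 - γ / 4)) * (D * P * R * #(C 0)) := by
          refine mul_le_mul_of_nonneg_right ?_ (by positivity)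
          nlinarith [mul_nonneg hγ.le hγ.le]
      _ = ((1 - γ / 4) * #(C 0)) * ((1 - γ / 2) * P * ((1 - γ / 4) * D * R)) := by ring
      _ ≤ #((C 0).filter fun v => GoodImage H G C q p δ η v)
            * ((1 - γ / 2) * P * ((1 - γ / 4) * D * R)) :=
          mul_le_mul_of_nonneg_right hcardgood hE0
      _ ≤ ∑ v ∈ C 0 with GoodImage H G C q p δ η v,
            (partiteCopies (H.comap Fin.succ) G (candidates H G C v) : ℝ) := by
          rw [← nsmul_eq_mul]
          exact card_nsmul_le_sum _ _ _ fun v hv => hgood v (mem_filter.1 hv).2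
      _ ≤ _ := sum_le_sum_of_subset_of_nonneg (filter_subset _ _)
            fun _ _ _ => Nat.cast_nonneg _

/-! ### From regular and bijumbled pairs to the initial state -/

theorem IsBijumbledPair.jumbled {Γ : SimpleGraph V} {p b : ℝ} {U W : Finset V}
    (h : IsBijumbledPair Γ p b U W) : Jumbled (adjKernel Γ) p b U W := fun A hA B hB => by
  refine le_trans (le_of_eq ?_) (h A hA B hB)
  rw [edgesBetween_eq_sum]
  simp only [sum_sub_distrib, sum_const, nsmul_eq_mul]
  congr 1
  ring

theorem pDensity_comm (G : SimpleGraph V) (p : ℝ) (U W : Finset V) :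
    pDensity G p U W = pDensity G p W U := by
  unfold pDensity
  rw [edgesBetween_eq_sum, edgesBetween_eq_sum, sum_comm, mul_right_comm]
  congr 1
  exact sum_congr rfl fun x _ => sum_congr rfl fun y _ => adjKernel_comm G _ _

theorem pDensity_nonneg (G : SimpleGraph V) {p : ℝ} (hp : 0 < p) (U W : Finset V) :
    0 ≤ pDensity G p U W := by
  unfold pDensity; positivity

theorem Jumbled.sum_adjKernel_le {G Γ : SimpleGraph V} (hG : G ≤ Γ) {p c : ℝ} {U W : Finset V}
    (h : Jumbled (adjKernel Γ) p (c * p * √((#U : ℝ) * #W)) U W) (hp : 0 < p) (hc : 0 ≤ c)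
    {A B : Finset V} (hA : A ⊆ U) (hB : B ⊆ W) :
    ∑ x ∈ A, ∑ y ∈ B, adjKernel G x y ≤ p * #A * #B + c * p * #U * #W := by
  have h1 := (le_abs_self _).trans (h A hA B hB)
  simp only [sum_sub_distrib, sum_const, nsmul_eq_mul] at h1
  have h2 : ∑ x ∈ A, ∑ y ∈ B, adjKernel G x y ≤ ∑ x ∈ A, ∑ y ∈ B, adjKernel Γ x y :=
    sum_le_sum fun x _ => sum_le_sum fun y _ => adjKernel_mono hG x y
  have h3 : √((#A : ℝ) * #B) ≤ √((#U : ℝ) * #W) := by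
    apply Real.sqrt_le_sqrt
    have := card_le_card hA
    have := card_le_card hB
    gcongr
  have h4 : c * p * √((#U : ℝ) * #W) * √((#A : ℝ) * #B) ≤ c * p * #U * #W := by
    calc _ ≤ c * p * √((#U : ℝ) * #W) * √((#U : ℝ) * #W) := by gcongr
      _ = c * p * (√((#U : ℝ) * #W) * √((#U : ℝ) * #W)) := by ring
      _ = _ := by rw [Real.mul_self_sqrt (by positivity)]; ring
  linarith

theorem pDensity_le_two {G Γ : SimpleGraph V} (hG : G ≤ Γ) {p c : ℝ} {U W : Finset V}
    (h : Jumbled (adjKernel Γ) p (c * p * √((#U : ℝ) * #W)) U W) (hp : 0 < p) (hc : 0 ≤ c)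
    (hc1 : c ≤ 1) : pDensity G p U W ≤ 2 := by
  unfold pDensity
  refine div_le_of_le_mul₀ (by positivity) (by norm_num) ?_
  rw [edgesBetween_eq_sum]
  refine (h.sum_adjKernel_le hG hp hc Subset.rfl Subset.rfl).trans ?_
  have : c * (p * #U * #W) ≤ 1 * (p * #U * #W) := by gcongr
  linarith

/-- On large sets this is regularity. Otherwise `|A||B| ≤ ε|U||W|`, and both the edge count and its
expected value `q p |A||B|` are nonnegative and at most `(2 * ε + c) * p * |U| * |W|`: the former by
jumbledness of `Γ`, the latter by `q ≤ 2`. -/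
theorem IsRegularPair.cutClose {G Γ : SimpleGraph V} (hG : G ≤ Γ) {p c ε : ℝ} {U W : Finset V}
    (hreg : IsRegularPair G ε p U W)
    (h : Jumbled (adjKernel Γ) p (c * p * √((#U : ℝ) * #W)) U W) (hp : 0 < p) (hc : 0 ≤ c)
    (hc1 : c ≤ 1) (hε : 0 ≤ ε) :
    CutClose (fun x y => adjKernel G x y - pDensity G p U W * p) ((2 * ε + c) * p * #U * #W)
      U W := by
  intro A hA B hB
  have hq0 := pDensity_nonneg G hp U W
  have hq2 := pDensity_le_two hG h hp hc hc1
  set q := pDensity G p U W with hq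
  have hAU : (#A : ℝ) ≤ #U := Nat.cast_le.2 (card_le_card hA)
  have hBW : (#B : ℝ) ≤ #W := Nat.cast_le.2 (card_le_card hB)
  have hnn : 0 ≤ c * p * #U * #W := by positivity
  have hnn' : 0 ≤ ε * p * #U * #W := by positivity
  simp only [sum_sub_distrib, sum_const, nsmul_eq_mul]
  by_cases hlarge : ε * (#U : ℝ) ≤ #A ∧ ε * (#W : ℝ) ≤ #B
  · have h1 := hreg A hA B hB hlarge.1 hlarge.2
    rcases A.eq_empty_or_nonempty with rfl | hAne
    · simp; positivity
    rcases B.eq_empty_or_nonempty with rfl | hBne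
    · simp; positivity
    have hA0 : (0 : ℝ) < #A := Nat.cast_pos.2 hAne.card_pos
    have hB0 : (0 : ℝ) < #B := Nat.cast_pos.2 hBne.card_pos
    have e : ∑ x ∈ A, ∑ y ∈ B, adjKernel G x y = pDensity G p A B * (p * #A * #B) := by
      unfold pDensity
      rw [edgesBetween_eq_sum]
      field_simp
    calc |∑ x ∈ A, ∑ y ∈ B, adjKernel G x y - #A * (#B * (q * p))|
        = |pDensity G p A B - q| * (p * #A * #B) := by
          rw [e, ← abs_of_pos (by positivity : 0 < p * #A * (#B : ℝ)), ← abs_mul,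
            abs_of_pos (by positivity : 0 < p * #A * (#B : ℝ))]
          congr 1; ring
      _ ≤ ε * (p * #U * #W) := by gcongr
      _ ≤ _ := by linarith
  · have hsmall : (#A : ℝ) * #B ≤ ε * (#U * #W) := by
      rcases not_and_or.1 hlarge with h1 | h1
      · calc (#A : ℝ) * #B ≤ (ε * #U) * #W :=
              mul_le_mul (not_le.1 h1).le hBW (by positivity) (by positivity)
          _ = _ := by ring
      · calc (#A : ℝ) * #B ≤ #U * (ε * #W) :=
              mul_le_mul hAU (not_le.1 h1).le (by positivity) (by positivity)
          _ = _ := by ring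
    have h1 := h.sum_adjKernel_le hG hp hc hA hB
    have h2 : 0 ≤ ∑ x ∈ A, ∑ y ∈ B, adjKernel G x y :=
      sum_nonneg fun x _ => sum_nonneg fun y _ => (adjKernel_unit G x y).1
    have h3 : p * ((#A : ℝ) * #B) ≤ p * (ε * (#U * #W)) := by gcongr
    have h4 : (#A : ℝ) * (#B * (q * p)) ≤ 2 * (p * ((#A : ℝ) * #B)) := by
      calc (#A : ℝ) * (#B * (q * p)) = q * (p * ((#A : ℝ) * #B)) := by ring
        _ ≤ _ := by gcongr
    have h5 : 0 ≤ (#A : ℝ) * (#B * (q * p)) := by positivity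
    rw [abs_le]
    constructor <;> linarith

theorem one_le_kReg {m : ℕ} {H : SimpleGraph (Fin m)} {i j : Fin m} (h : H.Adj i j) :
    1 ≤ kReg H := by
  have hk := (kReg_isLeast H h).1
  have main : ∀ i j, i < j → H.Adj i j → 1 ≤ kReg H := fun i j hij hadj => by
    have h1 := hk.1 i j hij hadj
    have h2 : 1 ≤ caseTerm H i j := by unfold caseTerm; split_ifs <;> norm_num
    have h3 : (0 : ℝ) ≤ numBefore H i i := Nat.cast_nonneg _
    have h4 : (0 : ℝ) ≤ numBefore H i j := Nat.cast_nonneg _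
    linarith
  rcases lt_or_gt_of_ne h.ne with hij | hij
  · exact main i j hij h
  · exact main j i hij h.symm

/-- Without edges `kReg H` is an infimum with no meaning, but all the bounds are vacuous. -/
theorem exponentBound_kReg {m : ℕ} (H : SimpleGraph (Fin m)) :
    ExponentBound H (fun _ => 0) (kReg H) := by
  by_cases h : ∃ i j, H.Adj i j
  · obtain ⟨i, j, h⟩ := h
    exact (show IsKRegBound H (kReg H) from (kReg_isLeast H h).1).exponentBound
  · push Not at h
    exact ⟨fun i j l _ _ h1 => (h _ _ h1).elim, fun i j l _ _ h1 => (h _ _ h1).elim,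
      fun i j l _ _ h1 => (h _ _ h1).elim⟩

theorem mem_orderedEdges {m : ℕ} {H : SimpleGraph (Fin m)} {e : Fin m × Fin m} :
    e ∈ orderedEdges H ↔ e.1 < e.2 ∧ H.Adj e.1 e.2 := by
  simp [orderedEdges]

theorem ncard_edgeSet_eq {m : ℕ} (H : SimpleGraph (Fin m)) :
    H.edgeSet.ncard = #(orderedEdges H) := by
  classical
  have e : H.edgeSet = (fun e : Fin m × Fin m => s(e.1, e.2)) '' (orderedEdges H : Set _) := by
    ext x
    induction x using Sym2.ind with
    | _ i j =>
      simp only [SimpleGraph.mem_edgeSet, Set.mem_image, orderedEdges, coe_filter, mem_univ,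
        true_and, Set.mem_ofPred_eq, Prod.exists]
      constructor
      · intro h
        rcases lt_or_gt_of_ne h.ne with hij | hij
        · exact ⟨i, j, ⟨hij, h⟩, rfl⟩
        · exact ⟨j, i, ⟨hij, h.symm⟩, Sym2.eq_swap⟩
      · rintro ⟨a, b, ⟨_, hab⟩, h⟩
        rw [← SimpleGraph.mem_edgeSet, ← h]
        exact hab
  rw [e, Set.InjOn.ncard_image, Set.ncard_coe_finset]
  rintro ⟨a, b⟩ h ⟨c, d⟩ h' heq
  have h1 : a < b := (mem_filter.1 h).2.1
  have h2 : c < d := (mem_filter.1 h').2.1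
  rcases Sym2.eq_iff.1 heq with ⟨rfl, rfl⟩ | ⟨rfl, rfl⟩
  · rfl
  · exact (lt_asymm h1 h2).elim

theorem le_of_lt_prod {ι : Type*} {s : Finset ι} {f : ι → ℝ} {γ : ℝ}
    (hf : ∀ i ∈ s, 0 ≤ f i ∧ f i ≤ 2) (h : γ < ∏ i ∈ s, f i) {i : ι} (hi : i ∈ s) :
    γ / 2 ^ #s ≤ f i := by
  classical
  rw [div_le_iff₀ (by positivity)]
  refine h.le.trans ?_
  rw [← mul_prod_erase s f hi]
  refine mul_le_mul_of_nonneg_left ?_ (hf i hi).1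
  calc ∏ j ∈ s.erase i, f j ≤ ∏ j ∈ s.erase i, (2 : ℝ) :=
        prod_le_prod (fun j hj => (hf j (mem_of_mem_erase hj)).1)
          fun j hj => (hf j (mem_of_mem_erase hj)).2
    _ = 2 ^ #(s.erase i) := prod_const _
    _ ≤ 2 ^ #s := pow_le_pow_right₀ (by norm_num) (card_le_card (erase_subset _ _))

end SparseCounting

theorem lemmaA1 (m : ℕ) (H : SimpleGraph (Fin m)) (γ : ℝ) (hγ : 0 < γ) :
    ∃ ε : ℝ, 0 < ε ∧ ∃ c : ℝ, 0 < c ∧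
      ∀ (p : ℝ), 0 < p → p ≤ 1 →
      ∀ (V : Type*) (G Γ : SimpleGraph V), G ≤ Γ →
      ∀ (W : Fin m → Finset V),
        (∀ i j, H.Adj i j →
          Disjoint (W i) (W j) ∧
          SparseCounting.IsRegularPair G ε p (W i) (W j) ∧
          SparseCounting.IsBijumbledPair Γ p
            (c * p ^ SparseCounting.kReg H * √(((W i).card : ℝ) * ((W j).card : ℝ)))
            (W i) (W j)) →
        (SparseCounting.densityProd H G p W - γ) * p ^ H.edgeSet.ncard * ∏ i, ((W i).card : ℝ)
          ≤ (SparseCounting.partiteCopies H G W : ℝ) := by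
  open SparseCounting in
  -- `γ'` serves both as relative error and as lower bound for the densities. Multiplied by a
  -- product of densities, each at most 2, it stays below `γ`.
  set γ' := min (γ / 2 ^ #(orderedEdges H)) 1 with hγ'
  have hγ'0 : 0 < γ' := lt_min (by positivity) one_pos
  obtain ⟨c, hc, hcount⟩ := EmbeddingState.exists_le_partiteCopies m H _ _ (exponentBound_kReg H)
    γ' hγ'0 (min_le_right _ _) γ' hγ'0 (min_le_right _ _)
  -- With `ε = c'` the cut norm constant is `2 * c' + c' ≤ c`.
  set c' := min (c / 3) 1 with hc'
  have hc'0 : 0 < c' := lt_min (by positivity) one_pos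
  have hc'3 : c' ≤ c / 3 := min_le_left _ _
  refine ⟨c', hc'0, c', hc'0, fun p hp hp1 V G Γ hG W hW => ?_⟩
  have hJ : ∀ i j, H.Adj i j →
      Jumbled (adjKernel Γ) p (c' * p ^ kReg H * √((#(W i) : ℝ) * #(W j))) (W i) (W j) :=
    fun i j h => (hW i j h).2.2.jumbled
  have hJ1 : ∀ i j, H.Adj i j →
      Jumbled (adjKernel Γ) p (c' * p * √((#(W i) : ℝ) * #(W j))) (W i) (W j) :=
    fun i j h => (hJ i j h).mono (by
      gcongr
      exact (Real.rpow_le_rpow_of_exponent_ge hp hp1 (one_le_kReg h)).trans_eq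
        (Real.rpow_one p)) Subset.rfl Subset.rfl
  set q : Fin m → Fin m → ℝ := fun i j => pDensity G p (W i) (W j) with hq
  have hq2 : ∀ i j, H.Adj i j → q i j ≤ 2 := fun i j h =>
    pDensity_le_two hG (hJ1 i j h) hp hc'0.le (min_le_right _ _)
  have hq0 : ∀ i j, 0 ≤ q i j := fun i j => pDensity_nonneg G hp _ _
  have hprod : densityProd H G p W = ∏ e ∈ orderedEdges H, q e.1 e.2 := rfl
  -- If the product is at most `γ`, the claimed lower bound is not positive. Otherwise no density
  -- can be small, as the remaining ones are at most 2.
  rcases le_or_gt (densityProd H G p W) γ with hle | hlt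
  · exact (mul_nonpos_of_nonpos_of_nonneg (mul_nonpos_of_nonpos_of_nonneg (sub_nonpos.2 hle)
      (pow_nonneg hp.le _)) (prod_nonneg fun _ _ => Nat.cast_nonneg _)).trans (Nat.cast_nonneg _)
  have hadj : ∀ e ∈ orderedEdges H, e.1 < e.2 ∧ H.Adj e.1 e.2 := fun e he =>
    mem_orderedEdges.1 he
  rw [hprod] at hlt
  have hql : ∀ e ∈ orderedEdges H, γ' ≤ q e.1 e.2 := fun e he => by
    have hf : ∀ e ∈ orderedEdges H, 0 ≤ q e.1 e.2 ∧ q e.1 e.2 ≤ 2 := fun e he =>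
      ⟨hq0 _ _, hq2 _ _ (hadj e he).2⟩
    exact (min_le_left _ _).trans (le_of_lt_prod hf hlt he)
  have hmul : ∀ x y : ℝ, 0 ≤ x → 0 ≤ y → (2 * c' + c') * p * x * y ≤ c * p * x * y :=
    fun x y hx hy => by
      have : 2 * c' + c' ≤ c := by linarith
      gcongr
  have hmul' : ∀ x y : ℝ, 0 ≤ x → 0 ≤ y → c' * x * y ≤ c * x * y := fun x y hx hy => by
    have : c' ≤ c := by linarith
    gcongr
  have hdens : ∀ i j, H.Adj i j → γ' ≤ q i j ∧ q i j ≤ 2 := fun i j h => by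
    refine ⟨?_, hq2 i j h⟩
    rcases lt_or_gt_of_ne h.ne with hij | hij
    · exact hql (i, j) (mem_orderedEdges.2 ⟨hij, h⟩)
    · exact (hql (j, i) (mem_orderedEdges.2 ⟨hij, h.symm⟩)).trans_eq (pDensity_comm G p _ _)
  have hstate : EmbeddingState H (fun _ => 0) (kReg H) c γ' p G Γ W q :=
    { density := hdens
      cut := fun i j h => ((hW i j h).2.1.cutClose hG (hJ1 i j h) hp hc'0.le (min_le_right _ _)
        hc'0.le).mono (hmul _ _ (Nat.cast_nonneg _) (Nat.cast_nonneg _)) Subset.rfl Subset.rfl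
      jumbled := fun i j h => by
        rw [Nat.cast_zero, zero_div, sub_zero, sub_zero]
        exact (hJ i j h).mono (hmul' _ _ (Real.rpow_nonneg hp.le _) (Real.sqrt_nonneg _))
          Subset.rfl Subset.rfl }
  refine le_trans ?_ (hcount p hp hp1 V G Γ hG W q hstate)
  rw [prod_mul_distrib, prod_const, ncard_edgeSet_eq, hprod, ← mul_assoc]
  refine mul_le_mul_of_nonneg_right ?_ (prod_nonneg fun _ _ => Nat.cast_nonneg _)
  refine mul_le_mul_of_nonneg_right ?_ (pow_nonneg hp.le _)
  have h1 : ∏ e ∈ orderedEdges H, q e.1 e.2 ≤ 2 ^ #(orderedEdges H) := by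
    rw [← prod_const]
    exact prod_le_prod (fun e _ => hq0 _ _) fun e he => hq2 _ _ (hadj e he).2
  have h2 : γ' * ∏ e ∈ orderedEdges H, q e.1 e.2 ≤ γ := by
    calc _ ≤ γ / 2 ^ #(orderedEdges H) * 2 ^ #(orderedEdges H) := by
          refine mul_le_mul (min_le_left _ _) h1 (prod_nonneg fun e _ => hq0 _ _) (by positivity)
      _ = γ := by field_simp
  linarith
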